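/- Let $N\ge 0$ and let $G=(V,E)$ be the $(N+2)\times(N+2)$ square grid graph, in which horizontally and vertically adjacent sites are joined by an edge. Let the interior $B\subseteq V$ be the set of sites with four neighbors (an $N\times N$ block), and let $\partial B=V\setminus B$. For $i\in V$ write $\partial i$ for the set of neighbors of $i$. Let $\mathbf x_{\partial B}\in\{-1,1\}^{\partial B}$ be a one-run boundary configuration, i.e. the set $R^+=\{i\in\partial B: x_i=+1\}$ induces a connected subgraph of $G$ (the empty set is allowed). For $\mathbf x_B\in\{-1,1\}^B$ let $O(\mathbf x_B,\mathbf x_{\partial B})$ be the number of edges $\{i,j\}\in E$ with at least one endpoint in $B$ and $x_i\neq x_j$. For $i\in B$ put $$O_i^*(\pm1)=\min_{\mathbf x_B:\,x_i=\pm1}O(\mathbf x_B,\mathbf x_{\partial B}),\qquad o_i^*=O_i^*(-1)-O_i^*(+1).$$ For each edge $\{i,j\}$ with $i\in B$ or $j\in B$ define the min-sum loopy belief propagation messages, for $s\in\{-1,1\}$, by $M^n_{j\to i}(s)=\mathbb I(x_j\ne s)$ for all $n\ge0$ if $j\in\partial B$; $M^0_{j\to i}(s)=0$ if $j\in B$;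 and $$M^n_{j\to i}(s)=\min_{t\in\{\pm1\}}\Big\{\mathbb I(s\neq t)+\sum_{k\in\partial j\setminus\{i\}}M^{n-1}_{k\to j}(t)\Big\}\qquad\text{if } j\in B,\ n>0.$$ Let $m^n_{j\to i}=M^n_{j\to i}(-1)-M^n_{j\to i}(+1)$ be the difference messages. (Equivalently, $m^n_{j\to i}=x_j$ if $j\in\partial B$; $m^0_{j\to i}=0$ if $j\in B$; and $m^n_{j\to i}=\operatorname{sign}\big(\sum_{k\in\partial j\setminus\{i\}}m^{n-1}_{k\to j}\big)$ if $j\in B$, $n>0$, where $\operatorname{sign}(0)=0$.) For $i\in B$ let $\hat o^n_i=\sum_{j\in\partial i}m^n_{j\to i}$. Theorem. For every edge $\{j,i\}$ of $G$ with $j\in B$ the difference messages $m^n_{j\to i}$ converge in $2N$ iterations: there is $\sigma\in\{-1,1\}$ with $m^n_{j\to i}=\sigma$ for all $n\ge 2N$. Moreover $\hat o^n_i=o^*_i$ for every $i\in B$ and all $n\ge 2N$. -/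

import Mathlib

namespace BlockInterp

/-- The sites of the `(N+2) × (N+2)` square lattice, with coordinates in `{0, …, N+1}`. -/
abbrev Site (N : ℕ) : Type := Fin (N + 2) × Fin (N + 2)

/-- The grid graph with the 4-neighbor topology: horizontally and vertically adjacent sites
are joined by an edge. -/
def grid (N : ℕ) : SimpleGraph (Site N) where
  Adj u v :=
    (u.2 = v.2 ∧ (u.1.val + 1 = v.1.val ∨ v.1.val + 1 = u.1.val)) ∨
    (u.1 = v.1 ∧ (u.2.val + 1 = v.2.val ∨ v.2.val + 1 = u.2.val))
  symm := ⟨fun u v h => by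
    rcases h with ⟨h1, h2⟩ | ⟨h1, h2⟩
    · exact Or.inl ⟨h1.symm, h2.symm⟩
    · exact Or.inr ⟨h1.symm, h2.symm⟩⟩
  loopless := ⟨fun u h => by omega⟩

instance (N : ℕ) : DecidableRel (grid N).Adj := fun u v =>
  inferInstanceAs (Decidable (
    (u.2 = v.2 ∧ (u.1.val + 1 = v.1.val ∨ v.1.val + 1 = u.1.val)) ∨
    (u.1 = v.1 ∧ (u.2.val + 1 = v.2.val ∨ v.2.val + 1 = u.2.val))))

/-- The interior `B`: the sites with four neighbors. The boundary is its complement. -/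
def interior (N : ℕ) : Finset (Site N) :=
  Finset.univ.filter fun v => (grid N).degree v = 4

/-- A boundary configuration: an assignment of a value in `{-1, 1}` to every site outside `B`. -/
abbrev BoundaryConfig (N : ℕ) : Type := {v : Site N // v ∉ interior N} → ℤˣ

/-- An interior configuration: an assignment of a value in `{-1, 1}` to every site of `B`. -/
abbrev InteriorConfig (N : ℕ) : Type := {v : Site N // v ∈ interior N} → ℤˣ

/-- The set `R⁺` of boundary sites with value `+1`. -/
def plusRun {N : ℕ} (xb : BoundaryConfig N) : Set (Site N) :=
  {v | ∃ h : v ∉ interior N, xb ⟨v, h⟩ = 1}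

/-- One-run boundary configuration: the subgraph induced on `R⁺` is connected, i.e. any two
sites of `R⁺` are joined by a path in `R⁺` (the empty set `R⁺` is allowed). -/
def IsOneRun {N : ℕ} (xb : BoundaryConfig N) : Prop :=
  ((grid N).induce (plusRun xb)).Preconnected

/-- The configuration on all sites given by an interior and a boundary configuration. -/
def glue {N : ℕ} (xB : InteriorConfig N) (xb : BoundaryConfig N) (v : Site N) : ℤˣ :=
  if h : v ∈ interior N then xB ⟨v, h⟩ else xb ⟨v, h⟩

/-- The number `O(x_B, x_∂B)` of odd bonds: edges with at least one endpoint in `B` whose two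
endpoints have different values. -/
def oddBonds {N : ℕ} (xB : InteriorConfig N) (xb : BoundaryConfig N) : ℕ :=
  ((grid N).edgeFinset.filter fun e =>
    (∃ v ∈ e, v ∈ interior N) ∧ ¬ (Sym2.map (glue xB xb) e).IsDiag).card

/-- `O*_i(s)`: the minimal number of odd bonds over the interior configurations with `x_i = s`. -/
def minOddBonds {N : ℕ} (xb : BoundaryConfig N) (i : {v : Site N // v ∈ interior N}) (s : ℤˣ) :
    ℕ :=
  (Finset.univ.filter fun xB : InteriorConfig N => xB i = s).inf' ⟨fun _ => s, by simp⟩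
    fun xB => oddBonds xB xb

/-- The local solution `o*_i = O*_i(-1) - O*_i(+1)`. -/
def localSolution {N : ℕ} (xb : BoundaryConfig N) (i : {v : Site N // v ∈ interior N}) : ℤ :=
  (minOddBonds xb i (-1) : ℤ) - (minOddBonds xb i 1 : ℤ)

/-- The min-sum message `M^n_{j→i}(s)` of loopy belief propagation. Messages from boundary sites
are fixed; messages from interior sites start at `0` and are updated synchronously.
Only the values at adjacent `j`, `i`, at least one of them in `B`, are meaningful. -/
def message {N : ℕ} (xb : BoundaryConfig N) : ℕ → Site N → Site N → ℤˣ → ℕ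
  | 0, j, _, s => if h : j ∈ interior N then 0 else if xb ⟨j, h⟩ = s then 0 else 1
  | n + 1, j, i, s =>
    if h : j ∈ interior N then
      (Finset.univ : Finset ℤˣ).inf' Finset.univ_nonempty fun t =>
        (if s = t then 0 else 1) +
          ∑ k ∈ ((grid N).neighborFinset j).erase i, message xb n k j t
    else if xb ⟨j, h⟩ = s then 0 else 1

/-- The difference message `m^n_{j→i} = M^n_{j→i}(-1) - M^n_{j→i}(+1)`. -/
def diffMessage {N : ℕ} (xb : BoundaryConfig N) (n : ℕ) (j i : Site N) : ℤ :=
  (message xb n j i (-1) : ℤ) - (message xb n j i 1 : ℤ)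

/-- The estimate of the local solution at `i` after `n` iterations: the sum of the difference
messages coming into `i`. -/
def estimate {N : ℕ} (xb : BoundaryConfig N) (n : ℕ) (i : Site N) : ℤ :=
  ∑ j ∈ (grid N).neighborFinset i, diffMessage xb n j i

/-- Difference messages from boundary sites are the boundary values. -/
theorem diffMessage_boundary {N : ℕ} (xb : BoundaryConfig N) (n : ℕ) (j i : Site N)
    (h : j ∉ interior N) : diffMessage xb n j i = ((xb ⟨j, h⟩ : ℤˣ) : ℤ) := by
  rcases Int.units_eq_one_or (xb ⟨j, h⟩) with hx | hx <;>
    cases n <;> simp [diffMessage, message, h, hx]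

/-- Difference messages from interior sites start at `0`. -/
theorem diffMessage_zero {N : ℕ} (xb : BoundaryConfig N) (j i : Site N)
    (h : j ∈ interior N) : diffMessage xb 0 j i = 0 := by
  simp [diffMessage, message, h]

/-- Difference messages from interior sites are updated to the sign of the sum of the messages
coming in from the other neighbors. -/
theorem diffMessage_succ {N : ℕ} (xb : BoundaryConfig N) (n : ℕ) (j i : Site N)
    (h : j ∈ interior N) : diffMessage xb (n + 1) j i =
      Int.sign (∑ k ∈ ((grid N).neighborFinset j).erase i, diffMessage xb n k j) := by
  have hu : (Finset.univ : Finset ℤˣ) = {1, -1} := rfl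
  simp only [diffMessage, message, h, dite_true, Finset.sum_sub_distrib]
  rw [← Nat.cast_sum, ← Nat.cast_sum]
  generalize hP : (∑ k ∈ ((grid N).neighborFinset j).erase i, message xb n k j (-1)) = P
  generalize hQ : (∑ k ∈ ((grid N).neighborFinset j).erase i, message xb n k j 1) = Q
  have key : ∀ s : ℤˣ, ((Finset.univ : Finset ℤˣ).inf' Finset.univ_nonempty fun t =>
      (if s = t then 0 else 1) +
        ∑ k ∈ ((grid N).neighborFinset j).erase i, message xb n k j t) =
      min ((if s = 1 then 0 else 1) + Q) ((if s = -1 then 0 else 1) + P) := by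
    intro s
    simp only [hu]
    rw [Finset.inf'_insert (Finset.singleton_nonempty _), Finset.inf'_singleton, hP, hQ]
  rw [key, key]
  have h1 : ¬ ((-1 : ℤˣ) = 1) := by decide
  have h2 : ¬ ((1 : ℤˣ) = -1) := by decide
  simp only [h1, h2, if_true, if_false]
  rcases lt_trichotomy P Q with hlt | heq | hgt
  · rw [Int.sign_eq_neg_one_of_neg (by omega)]; omega
  · subst heq; simp
  · rw [Int.sign_eq_one_of_pos (by omega)]; omega

end BlockInterp

namespace BlockInterp

/-! Read the boundary clockwise as a cyclic ±1 word `w`. One-run means that no four boundary sites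
in cyclic order carry alternating values (`oneRunWord_boundaryWord`). The row and column through an
interior site `p` meet the boundary in four ends, which cut the boundary into four windows.
Non-alternation leaves three patterns of ends (`ends_cases`): all equal, all but one equal, or two
adjacent equal pairs. In each pattern it also forces certain windows to be constant.

Messages: if the window between directions `k` and `k + 1` is constantly `σ`, then the messages
reaching `p` from these directions become `σ` (`eq_of_mono`). Each is the sign of three messages,
two of which come from a smaller constant window of the neighbor, and the third cannot outvote them.
The time needed is governed by the two gaps, whose sum is at most `2N`.

Costs: odd bonds are counted row by row and column by column. Each line has at least 0 or 1 changes
according to whether its ends agree. `lineMajority`, the majority of the four line ends with a fixed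
tie-break, attains all these minima at once. Hence one value at `p` has cost `baseCost`. The other
value is bounded below by excess changes on lines at or next to `p`, and above by a majority
configuration, flipped at `p` unless the ends tie. The differences 4, 2, 0 match the limiting sums
of messages pattern by pattern. When exactly one end differs, the line ends of the neighbor in that
direction decide between 4 and 2. -/

/-! ### Boundary words, line ends and windows -/

/-- The neighbor of `p` in direction `d`: up, right, down, left. -/
def step (d : Fin 4) (p : ℕ × ℕ) : ℕ × ℕ :=
  match d with
  | 0 => (p.1 - 1, p.2)
  | 1 => (p.1, p.2 + 1)
  | 2 => (p.1 + 1, p.2)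
  | 3 => (p.1, p.2 - 1)

/-- The distance from `p` to the side of the square `[0, K]²` in direction `d`. -/
def gap (K : ℕ) (d : Fin 4) (p : ℕ × ℕ) : ℕ :=
  match d with
  | 0 => p.1
  | 1 => K - p.2
  | 2 => K - p.1
  | 3 => p.2

/-- `p` lies strictly inside the square `[0, K]²`. -/
def Inside (K : ℕ) (p : ℕ × ℕ) : Prop := 0 < p.1 ∧ p.1 < K ∧ 0 < p.2 ∧ p.2 < K

/-- A `±1`-valued word, indexed clockwise along the boundary of `[0, K]²` from the top left corner,
that changes sign at most twice around the boundary. -/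
structure OneRunWord (K : ℕ) (w : ℕ → ℤ) : Prop where
  unit : ∀ t, w t = 1 ∨ w t = -1
  periodic : ∀ t < 4 * K, w (t + 4 * K) = w t
  noAlt : ∀ a b c d, a < b → b < c → c < d → d < a + 4 * K → d < 8 * K →
    w a = w c → w b = w d → w a = w b

/-- The boundary value at the end in direction `d` of the line through `p`. -/
def lineEnd (K : ℕ) (w : ℕ → ℤ) (d : Fin 4) (p : ℕ × ℕ) : ℤ :=
  w (d.val * K + gap K (d + 3) p)

/-- The boundary word is constantly `σ` between the ends in directions `k` and `k + 1` of the
lines through `p`. -/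
def Mono (K : ℕ) (w : ℕ → ℤ) (k : Fin 4) (p : ℕ × ℕ) (σ : ℤ) : Prop :=
  ∀ t, (k.val + 1) * K ≤ t + gap K (k + 1) p → t ≤ (k.val + 1) * K + gap K k p → w t = σ

/-- A value `-σ` inside the window and the end `-σ` outside it would alternate with the two ends `σ`
of the window. -/
theorem OneRunWord.mono_of_ends {K : ℕ} {w : ℕ → ℤ} (hw : OneRunWord K w) {p : ℕ × ℕ}
    (hp : Inside K p) {σ : ℤ} (k j : Fin 4) (h1 : lineEnd K w k p = σ)
    (h2 : lineEnd K w (k + 1) p = σ) (h3 : lineEnd K w j p = -σ) : Mono K w k p σ := by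
  obtain ⟨r, c⟩ := p
  obtain ⟨hr, hr', hc, hc'⟩ := hp
  simp only at hr hr' hc hc'
  intro t ht ht'
  by_contra hne
  have hσ : σ = 1 ∨ σ = -1 := h1 ▸ hw.unit _
  have hwt : w t = -σ := by have := hw.unit t; omega
  have key : ∀ a b s, w a = σ → w b = σ → w s = -σ → a ≤ t → t ≤ b → b < s →
      s < a + 4 * K → s < 8 * K → False := by
    intro a b s ha hb hs hat htb hbs hsa hs8
    have hat' : a ≠ t := by rintro rfl; omega
    have htb' : t ≠ b := by rintro rfl; omega
    have := hw.noAlt a t b s (by omega) (by omega) hbs hsa hs8 (by omega) (by omega)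
    omega
  -- Windows or ends that pass the top left corner are read on the second lap of the word.
  have p0 := hw.periodic c (by omega)
  have p1 := hw.periodic (K + r) (by omega)
  have p2 := hw.periodic (2 * K + (K - c)) (by omega)
  fin_cases k <;> fin_cases j <;> simp [lineEnd, gap] at h1 h2 h3 ht ht' <;> try omega
  · exact key c (K + r) (2 * K + (K - c)) h1 h2 h3 (by omega) (by omega) (by omega) (by omega)
      (by omega)
  · exact key c (K + r) (3 * K + (K - r)) h1 h2 h3 (by omega) (by omega) (by omega) (by omega)
      (by omega)
  · exact key (K + r) (2 * K + (K - c)) (c + 4 * K) h1 h2 (by omega) (by omega) (by omega)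
      (by omega) (by omega) (by omega)
  · exact key (K + r) (2 * K + (K - c)) (3 * K + (K - r)) h1 h2 h3 (by omega) (by omega)
      (by omega) (by omega) (by omega)
  · exact key (2 * K + (K - c)) (3 * K + (K - r)) (c + 4 * K) h1 h2 (by omega) (by omega)
      (by omega) (by omega) (by omega) (by omega)
  · exact key (2 * K + (K - c)) (3 * K + (K - r)) (K + r + 4 * K) h1 h2 (by omega) (by omega)
      (by omega) (by omega) (by omega) (by omega)
  · exact key (3 * K + (K - r)) (c + 4 * K) (K + r + 4 * K) h1 (by omega) (by omega) (by omega)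
      (by omega) (by omega) (by omega) (by omega)
  · exact key (3 * K + (K - r)) (c + 4 * K) (2 * K + (K - c) + 4 * K) h1 (by omega) (by omega)
      (by omega) (by omega) (by omega) (by omega) (by omega)

/-- Values `-σ` in two different windows would be separated on both sides by line ends of value `σ`.
So at most one window fails to be constant. -/
theorem OneRunWord.mono_or_mono {K : ℕ} {w : ℕ → ℤ} (hw : OneRunWord K w) {p : ℕ × ℕ}
    (hp : Inside K p) {σ : ℤ} (h : ∀ d, lineEnd K w d p = σ) {i j : Fin 4} (hij : i < j) :
    Mono K w i p σ ∨ Mono K w j p σ := by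
  obtain ⟨r, c⟩ := p
  obtain ⟨hr, hr', hc, hc'⟩ := hp
  simp only at hr hr' hc hc'
  by_contra hcon
  simp only [Mono, not_or, not_forall] at hcon
  obtain ⟨⟨s, hs, hs', hsn⟩, t, ht, ht', htn⟩ := hcon
  have hσ : σ = 1 ∨ σ = -1 := h 0 ▸ hw.unit _
  have hws : w s = -σ := by have := hw.unit s; omega
  have hwt : w t = -σ := by have := hw.unit t; omega
  have key : ∀ a b, w a = σ → w b = σ → s ≤ a → a ≤ t → t ≤ b → b < s + 4 * K → b < 8 * K →
      False := by
    intro a b ha hb hsa hat htb hbs hb8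
    have h1 : s ≠ a := by rintro rfl; omega
    have h2 : a ≠ t := by rintro rfl; omega
    have h3 : t ≠ b := by rintro rfl; omega
    have := hw.noAlt s a t b (by omega) (by omega) (by omega) (by omega) hb8 (by omega)
      (by omega)
    omega
  have p0 := hw.periodic c (by omega)
  have e0 := h 0
  have e1 := h 1
  have e2 := h 2
  have e3 := h 3
  -- Excluding the first endpoint of window 0 makes `c + 4 * K < s + 4 * K` strict, as `noAlt` needs
  -- less than one full lap.
  have n0 : s ≠ c := by rintro rfl; simp [lineEnd, gap] at e0; omega
  simp [lineEnd, gap] at e0 e1 e2 e3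
  fin_cases i <;> fin_cases j <;> simp [gap] at hs hs' ht ht' hij
  · exact key (K + r) (2 * K + (K - c)) e1 e2 (by omega) (by omega) (by omega) (by omega)
      (by omega)
  · exact key (K + r) (3 * K + (K - r)) e1 e3 (by omega) (by omega) (by omega) (by omega)
      (by omega)
  · exact key (K + r) (c + 4 * K) e1 (by omega) (by omega) (by omega) (by omega) (by omega)
      (by omega)
  · exact key (2 * K + (K - c)) (3 * K + (K - r)) e2 e3 (by omega) (by omega) (by omega)
      (by omega) (by omega)
  · exact key (2 * K + (K - c)) (c + 4 * K) e2 (by omega) (by omega) (by omega) (by omega)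
      (by omega) (by omega)
  · exact key (3 * K + (K - r)) (c + 4 * K) e3 (by omega) (by omega) (by omega) (by omega)
      (by omega) (by omega)

theorem OneRunWord.exists_mono_of_ne {K : ℕ} {w : ℕ → ℤ} (hw : OneRunWord K w) {p : ℕ × ℕ}
    (hp : Inside K p) {σ : ℤ} (h : ∀ d, lineEnd K w d p = σ) :
    ∃ k, ∀ j, j ≠ k → Mono K w j p σ := by
  by_cases hall : ∀ j, Mono K w j p σ
  · exact ⟨0, fun j _ => hall j⟩
  · push Not at hall
    obtain ⟨k, hk⟩ := hall
    refine ⟨k, fun j hj => ?_⟩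
    rcases lt_or_gt_of_ne hj with hlt | hgt
    · exact (hw.mono_or_mono hp h hlt).resolve_right hk
    · exact (hw.mono_or_mono hp h hgt).resolve_left hk

/-- Ends of opposite sides cannot separate each other; up to rotation, the four line ends are all
equal, or all but one are equal, or split into two adjacent pairs. -/
theorem OneRunWord.ends_cases {K : ℕ} {w : ℕ → ℤ} (hw : OneRunWord K w) {p : ℕ × ℕ}
    (hp : Inside K p) : ∃ σ : ℤ, (σ = 1 ∨ σ = -1) ∧
      ((∀ d, lineEnd K w d p = σ) ∨
        (∃ e : Fin 4, lineEnd K w e p = -σ ∧ ∀ d, d ≠ e → lineEnd K w d p = σ) ∨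
        (∃ k : Fin 4, lineEnd K w k p = σ ∧ lineEnd K w (k + 1) p = σ ∧
          lineEnd K w (k + 2) p = -σ ∧ lineEnd K w (k + 3) p = -σ)) := by
  have hna : ¬ (lineEnd K w 0 p = lineEnd K w 2 p ∧ lineEnd K w 1 p = lineEnd K w 3 p ∧
      lineEnd K w 0 p ≠ lineEnd K w 1 p) := by
    rintro ⟨h1, h2, h3⟩
    obtain ⟨r, c⟩ := p
    obtain ⟨hr, hr', hc, hc'⟩ := hp
    simp only at hr hr' hc hc'
    simp [lineEnd, gap] at h1 h2 h3
    exact h3 (hw.noAlt _ _ _ _ (by omega) (by omega) (by omega) (by omega) (by omega) h1 h2)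
  have hu : ∀ d, lineEnd K w d p = 1 ∨ lineEnd K w d p = -1 := fun d => hw.unit _
  generalize lineEnd K w = f at *
  have u0 := hu 0
  have u1 := hu 1
  have u2 := hu 2
  have u3 := hu 3
  simp only [Fin.forall_fin_succ, Fin.exists_fin_succ]
  simp
  rcases u0 with u0 | u0 <;> rcases u1 with u1 | u1 <;> rcases u2 with u2 | u2 <;>
    rcases u3 with u3 | u3 <;> simp [u0, u1, u2, u3] at hna ⊢

/-! ### Convergence of the messages -/

/-- The recursion of the difference messages on the square `[0, K]²` with boundary word `w`:
`I n d p` is the message that `p` receives at time `n` from its neighbor in direction `d`. -/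
structure IncomingMessages (K : ℕ) (w : ℕ → ℤ) (I : ℕ → Fin 4 → ℕ × ℕ → ℤ) : Prop where
  boundary : ∀ n d p, Inside K p → ¬ Inside K (step d p) → I n d p = lineEnd K w d p
  abs_le : ∀ n d p, Inside K p → -1 ≤ I n d p ∧ I n d p ≤ 1
  succ : ∀ n d p, Inside K (step d p) → I (n + 1) d p =
    Int.sign (I n d (step d p) + I n (d + 1) (step d p) + I n (d + 3) (step d p))

theorem sign_eq_of_two {σ a b c : ℤ} (hσ : σ = 1 ∨ σ = -1) (ha : a = σ) (hb : b = σ)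
    (hc : -1 ≤ c ∧ c ≤ 1) {s : ℤ} (hs : s = a + b + c) : Int.sign s = σ := by
  rcases hσ with rfl | rfl
  · exact Int.sign_eq_one_of_pos (by omega)
  · exact Int.sign_eq_neg_one_of_neg (by omega)

theorem lineEnd_of_mono {K : ℕ} {w : ℕ → ℤ} {p : ℕ × ℕ} (hp : Inside K p) {k : Fin 4} {σ : ℤ}
    (h : Mono K w k p σ) : lineEnd K w k p = σ := by
  obtain ⟨r, c⟩ := p
  obtain ⟨hr, hr', hc, hc'⟩ := hp
  simp only at hr hr' hc hc'
  refine h _ ?_ ?_ <;> fin_cases k <;> simp [gap] <;> omega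

theorem lineEnd_succ_of_mono {K : ℕ} {w : ℕ → ℤ} (hw : OneRunWord K w) {p : ℕ × ℕ}
    (hp : Inside K p) {k : Fin 4} {σ : ℤ} (h : Mono K w k p σ) : lineEnd K w (k + 1) p = σ := by
  obtain ⟨r, c⟩ := p
  obtain ⟨hr, hr', hc, hc'⟩ := hp
  simp only at hr hr' hc hc'
  have h1 := h ((k.val + 1) * K + gap K k (r, c)) (by omega) le_rfl
  have p0 := hw.periodic c (by omega)
  fin_cases k <;> simp [gap, lineEnd] at h1 ⊢ <;> try exact h1
  rw [← p0, ← h1]; congr 1; omega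

/-- Moving in direction `k` can only shorten `gap k` and leaves `gap (k + 1)` alone, so the new
window lies inside the old one. -/
theorem Mono.step_left {K : ℕ} {w : ℕ → ℤ} {p : ℕ × ℕ} {k : Fin 4} {σ : ℤ}
    (h : Mono K w k p σ) : Mono K w k (step k p) σ := by
  obtain ⟨r, c⟩ := p
  intro t ht ht'
  apply h t <;> fin_cases k <;> simp [gap, step] at ht ht' ⊢ <;> omega

theorem Mono.step_right {K : ℕ} {w : ℕ → ℤ} {p : ℕ × ℕ} {k : Fin 4} {σ : ℤ}
    (h : Mono K w k p σ) : Mono K w k (step (k + 1) p) σ := by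
  obtain ⟨r, c⟩ := p
  intro t ht ht'
  apply h t <;> fin_cases k <;> simp [gap, step] at ht ht' ⊢ <;> omega

/-- Induction on time. The neighbor in direction `k` or `k + 1` inherits the constant window with
one gap shorter by one, so two of the three messages it combines are already `σ`. The offset 2 fits
the start: both gaps are at least 1, so at time 0 both are 1 and both neighbors are boundary sites.
-/
theorem IncomingMessages.eq_of_mono {K : ℕ} {w : ℕ → ℤ} (hw : OneRunWord K w)
    {I : ℕ → Fin 4 → ℕ × ℕ → ℤ} (hI : IncomingMessages K w I) {k : Fin 4} {σ : ℤ} (n : ℕ) :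
    ∀ p, Inside K p → Mono K w k p σ → gap K k p + gap K (k + 1) p ≤ n + 2 →
      I n k p = σ ∧ I n (k + 1) p = σ := by
  induction n with
  | zero =>
    intro p hp hm hg
    constructor
    · rw [hI.boundary _ _ _ hp, lineEnd_of_mono hp hm]
      intro hin
      obtain ⟨r, c⟩ := p
      fin_cases k <;> simp [Inside, step, gap] at hp hin hg <;> omega
    · rw [hI.boundary _ _ _ hp, lineEnd_succ_of_mono hw hp hm]
      intro hin
      obtain ⟨r, c⟩ := p
      fin_cases k <;> simp [Inside, step, gap] at hp hin hg <;> omega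
  | succ n ih =>
    intro p hp hm hg
    have hσ : σ = 1 ∨ σ = -1 := lineEnd_of_mono hp hm ▸ hw.unit _
    constructor
    · by_cases hin : Inside K (step k p)
      · obtain ⟨h1, h2⟩ := ih (step k p) hin hm.step_left (by
          obtain ⟨r, c⟩ := p
          fin_cases k <;> simp [Inside, step, gap] at hp hin hg ⊢ <;> omega)
        rw [hI.succ _ _ _ hin]
        exact sign_eq_of_two hσ h1 h2 (hI.abs_le n _ _ hin) rfl
      · rw [hI.boundary _ _ _ hp hin, lineEnd_of_mono hp hm]
    · by_cases hin : Inside K (step (k + 1) p)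
      · obtain ⟨h1, h2⟩ := ih (step (k + 1) p) hin hm.step_right (by
          obtain ⟨r, c⟩ := p
          fin_cases k <;> simp [Inside, step, gap] at hp hin hg ⊢ <;> omega)
        -- At the neighbor in direction `k + 1` the decisive messages come from `k + 1` and from `(k
        -- + 1) + 3 = k`.
        have hk : k + 1 + 3 = k := by fin_cases k <;> rfl
        rw [hI.succ _ _ _ hin, hk]
        exact sign_eq_of_two hσ h1 h2 (hI.abs_le n (k + 1 + 1) _ hin) (by ring)
      · rw [hI.boundary _ _ _ hp hin, lineEnd_succ_of_mono hw hp hm]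

/-- Source of the bound `2N`: each gap of an interior site is at most `N`. The offset 2 in
`eq_of_mono` leaves room for the extra update in `eq_of_mono_step`. -/
theorem gap_add_gap_le {N : ℕ} {p : ℕ × ℕ} (hp : Inside (N + 1) p) (d e : Fin 4) :
    gap (N + 1) d p + gap (N + 1) e p ≤ 2 * N := by
  obtain ⟨r, c⟩ := p
  fin_cases d <;> fin_cases e <;> simp [Inside, gap] at hp ⊢ <;> omega

theorem IncomingMessages.eq_of_mono_of_le {N : ℕ} {w : ℕ → ℤ} (hw : OneRunWord (N + 1) w)
    {I : ℕ → Fin 4 → ℕ × ℕ → ℤ} (hI : IncomingMessages (N + 1) w I) {σ : ℤ} {n : ℕ}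
    (hn : 2 * N ≤ n) {p : ℕ × ℕ} (hp : Inside (N + 1) p) {k d : Fin 4}
    (hk : Mono (N + 1) w k p σ) (hd : d = k ∨ d = k + 1) : I n d p = σ := by
  have := hI.eq_of_mono hw n p hp hk (by have := gap_add_gap_le hp k (k + 1); omega)
  rcases hd with rfl | rfl
  exacts [this.1, this.2]

/-- A message out of an interior site is determined by either of the two windows adjacent to the
side it comes from, or by the other two windows if they have the same color. -/
theorem IncomingMessages.eq_of_mono_step {N : ℕ} {w : ℕ → ℤ} (hw : OneRunWord (N + 1) w)
    {I : ℕ → Fin 4 → ℕ × ℕ → ℤ} (hI : IncomingMessages (N + 1) w I) {σ : ℤ} {n : ℕ}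
    (hn : 2 * N ≤ n) {p : ℕ × ℕ} {d : Fin 4} (hq : Inside (N + 1) (step d p))
    (h : Mono (N + 1) w d (step d p) σ ∨ Mono (N + 1) w (d + 3) (step d p) σ ∨
      Mono (N + 1) w (d + 1) (step d p) σ ∧ Mono (N + 1) w (d + 2) (step d p) σ) :
    I n d p = σ := by
  have hN : 1 ≤ N := by obtain ⟨h1, h2, -⟩ := hq; omega
  obtain ⟨m, rfl⟩ : ∃ m, n = m + 1 := ⟨n - 1, by omega⟩
  have key : ∀ k, Mono (N + 1) w k (step d p) σ → (σ = 1 ∨ σ = -1) ∧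
      I m k (step d p) = σ ∧ I m (k + 1) (step d p) = σ := fun k hk =>
    ⟨lineEnd_of_mono hq hk ▸ hw.unit _, hI.eq_of_mono hw m _ hq hk
      (by have := gap_add_gap_le hq k (k + 1); omega)⟩
  have hab := hI.abs_le m
  rw [hI.succ _ _ _ hq]
  have e1 : d + 3 + 1 = d := by fin_cases d <;> rfl
  have e2 : d + 2 + 1 = d + 3 := by fin_cases d <;> rfl
  rcases h with h | h | ⟨h, h'⟩
  · obtain ⟨hσ, h1, h2⟩ := key _ h
    exact sign_eq_of_two hσ h1 h2 (hab (d + 3) _ hq) rfl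
  · obtain ⟨hσ, h1, h2⟩ := key _ h
    rw [e1] at h2
    exact sign_eq_of_two hσ h1 h2 (hab (d + 1) _ hq) (by ring)
  · obtain ⟨hσ, h1, -⟩ := key _ h
    obtain ⟨-, -, h2⟩ := key _ h'
    rw [e2] at h2
    exact sign_eq_of_two hσ h1 h2 (hab d _ hq) (by ring)

/-- Apply the patterns of ends to the sending site. If all ends agree, at most one window is bad, so
one of the two windows bordering direction `d` is constant. If only end `e` differs, the two windows
away from `e` are constant; they contain the ends of every direction but `e`, and for `d = e` they
fix both side messages. For two pairs, the opposite windows `k` and `k + 2` are constant and one of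
them borders direction `d`. -/
theorem IncomingMessages.exists_limit {N : ℕ} {w : ℕ → ℤ} (hw : OneRunWord (N + 1) w)
    {I : ℕ → Fin 4 → ℕ × ℕ → ℤ} (hI : IncomingMessages (N + 1) w I) {p : ℕ × ℕ} {d : Fin 4}
    (hq : Inside (N + 1) (step d p)) :
    ∃ σ : ℤ, (σ = 1 ∨ σ = -1) ∧ ∀ n, 2 * N ≤ n → I n d p = σ := by
  suffices h : ∃ σ : ℤ, (σ = 1 ∨ σ = -1) ∧ (Mono (N + 1) w d (step d p) σ ∨
      Mono (N + 1) w (d + 3) (step d p) σ ∨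
      Mono (N + 1) w (d + 1) (step d p) σ ∧ Mono (N + 1) w (d + 2) (step d p) σ) by
    obtain ⟨σ, hσ, h⟩ := h
    exact ⟨σ, hσ, fun n hn => hI.eq_of_mono_step hw hn hq h⟩
  generalize step d p = q at hq
  obtain ⟨σ, hσ, h | ⟨e, he, h⟩ | ⟨k, h0, h1, h2, h3⟩⟩ := hw.ends_cases hq
  · obtain ⟨k, hk⟩ := hw.exists_mono_of_ne hq h
    refine ⟨σ, hσ, ?_⟩
    by_cases hd : d = k
    · exact Or.inr (Or.inl (hk _ (by subst hd; clear * -; revert d; decide)))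
    · exact Or.inl (hk _ hd)
  · have m1 := hw.mono_of_ends hq (e + 1) e (h _ (by clear * -; revert e; decide))
      (h _ (by clear * -; revert e; decide)) he
    have m2 := hw.mono_of_ends hq (e + 2) e (h _ (by clear * -; revert e; decide))
      (h _ (by clear * -; revert e; decide)) he
    refine ⟨σ, hσ, ?_⟩
    have : d = e ∨ d = e + 1 ∨ d = e + 2 ∨ d = e + 3 := by clear * -; revert d e; decide
    rcases this with rfl | rfl | rfl | rfl
    · exact Or.inr (Or.inr ⟨m1, m2⟩)
    · exact Or.inl m1
    · exact Or.inl m2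
    · refine Or.inr (Or.inl ?_)
      convert m2 using 1
      clear * -; revert e; decide
  · have m1 := hw.mono_of_ends hq k (k + 2) h0 h1 h2
    have m2 := hw.mono_of_ends (σ := -σ) hq (k + 2) k h2
      (by rw [← h3]; congr 1; clear * -; revert k; decide) (by omega)
    have : d = k ∨ d = k + 1 ∨ d = k + 2 ∨ d = k + 3 := by clear * -; revert d k; decide
    rcases this with rfl | rfl | rfl | rfl
    · exact ⟨σ, hσ, Or.inl m1⟩
    · refine ⟨σ, hσ, Or.inr (Or.inl ?_)⟩
      convert m1 using 1; clear * -; revert k; decide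
    · exact ⟨-σ, by omega, Or.inl m2⟩
    · refine ⟨-σ, by omega, Or.inr (Or.inl ?_)⟩
      convert m2 using 1; clear * -; revert k; decide

/-! ### Limiting sums of incoming messages -/

theorem sum_directions (f : Fin 4 → ℤ) (d : Fin 4) :
    ∑ e, f e = f d + f (d + 1) + f (d + 2) + f (d + 3) := by
  rw [Fin.sum_univ_four]
  fin_cases d <;> simp <;> ring

/-- Every direction borders two windows, and at most one window is not constant. -/
theorem IncomingMessages.sum_of_ends_eq {N : ℕ} {w : ℕ → ℤ} (hw : OneRunWord (N + 1) w)
    {I : ℕ → Fin 4 → ℕ × ℕ → ℤ} (hI : IncomingMessages (N + 1) w I) {σ : ℤ} {n : ℕ}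
    (hn : 2 * N ≤ n) {p : ℕ × ℕ} (hp : Inside (N + 1) p)
    (h : ∀ d, lineEnd (N + 1) w d p = σ) : ∑ d, I n d p = 4 * σ := by
  obtain ⟨k, hk⟩ := hw.exists_mono_of_ne hp h
  have : ∀ d, I n d p = σ := by
    intro d
    by_cases hd : d = k
    · exact hI.eq_of_mono_of_le hw hn hp (hk (d + 3) (by subst hd; clear * -; revert d; decide))
        (Or.inr (by clear * -; revert d; decide))
    · exact hI.eq_of_mono_of_le hw hn hp (hk d hd) (Or.inl rfl)
  simp [this]

theorem IncomingMessages.sum_of_ends_pairs {N : ℕ} {w : ℕ → ℤ} (hw : OneRunWord (N + 1) w)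
    {I : ℕ → Fin 4 → ℕ × ℕ → ℤ} (hI : IncomingMessages (N + 1) w I) {σ : ℤ} {n : ℕ}
    (hn : 2 * N ≤ n) {p : ℕ × ℕ} (hp : Inside (N + 1) p) {k : Fin 4}
    (h0 : lineEnd (N + 1) w k p = σ) (h1 : lineEnd (N + 1) w (k + 1) p = σ)
    (h2 : lineEnd (N + 1) w (k + 2) p = -σ) (h3 : lineEnd (N + 1) w (k + 3) p = -σ) :
    ∑ d, I n d p = 0 := by
  have m1 := hw.mono_of_ends hp k (k + 2) h0 h1 h2
  have m2 := hw.mono_of_ends (σ := -σ) hp (k + 2) k h2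
    (by rw [← h3]; congr 1; clear * -; revert k; decide) (by omega)
  rw [sum_directions _ k, hI.eq_of_mono_of_le hw hn hp m1 (Or.inl rfl),
    hI.eq_of_mono_of_le hw hn hp m1 (Or.inr rfl), hI.eq_of_mono_of_le hw hn hp m2 (Or.inl rfl),
    hI.eq_of_mono_of_le (d := k + 3) hw hn hp m2 (Or.inr (by clear * -; revert k; decide))]
  ring

/-- The two windows not touching end `e` fix three messages; the message from `e` is left to the
distinction between far and near. -/
theorem IncomingMessages.sum_of_ends_but_one {N : ℕ} {w : ℕ → ℤ} (hw : OneRunWord (N + 1) w)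
    {I : ℕ → Fin 4 → ℕ × ℕ → ℤ} (hI : IncomingMessages (N + 1) w I) {σ : ℤ} {n : ℕ}
    (hn : 2 * N ≤ n) {p : ℕ × ℕ} (hp : Inside (N + 1) p) {e : Fin 4}
    (he : lineEnd (N + 1) w e p = -σ) (h : ∀ d, d ≠ e → lineEnd (N + 1) w d p = σ) :
    ∑ d, I n d p = 3 * σ + I n e p := by
  have m1 := hw.mono_of_ends hp (e + 1) e (h _ (by clear * -; revert e; decide))
    (h _ (by clear * -; revert e; decide)) he
  have m2 := hw.mono_of_ends hp (e + 2) e (h _ (by clear * -; revert e; decide))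
    (h _ (by clear * -; revert e; decide)) he
  rw [sum_directions _ e, hI.eq_of_mono_of_le hw hn hp m1 (Or.inl rfl),
    hI.eq_of_mono_of_le hw hn hp m2 (Or.inl rfl),
    hI.eq_of_mono_of_le (d := e + 3) hw hn hp m2 (Or.inr (by clear * -; revert e; decide))]
  ring

theorem lineEnd_step {K : ℕ} {w : ℕ → ℤ} {p : ℕ × ℕ} {d : Fin 4} :
    lineEnd K w d (step d p) = lineEnd K w d p ∧
      lineEnd K w (d + 2) (step d p) = lineEnd K w (d + 2) p := by
  fin_cases d <;> simp [lineEnd, step, gap]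

/-- The neighbor toward `e` also sees only one end `-σ`, so its two side messages are `σ` and
outvote whatever arrives from direction `e`. -/
theorem IncomingMessages.sum_of_ends_far {N : ℕ} {w : ℕ → ℤ} (hw : OneRunWord (N + 1) w)
    {I : ℕ → Fin 4 → ℕ × ℕ → ℤ} (hI : IncomingMessages (N + 1) w I) {σ : ℤ} {n : ℕ}
    (hn : 2 * N ≤ n) {p : ℕ × ℕ} (hp : Inside (N + 1) p) {e : Fin 4}
    (he : lineEnd (N + 1) w e p = -σ) (h : ∀ d, d ≠ e → lineEnd (N + 1) w d p = σ)
    (hq : Inside (N + 1) (step e p)) (h1 : lineEnd (N + 1) w (e + 1) (step e p) = σ)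
    (h3 : lineEnd (N + 1) w (e + 3) (step e p) = σ) : ∑ d, I n d p = 4 * σ := by
  have he' : lineEnd (N + 1) w e (step e p) = -σ := by rw [lineEnd_step.1, he]
  have h2 : lineEnd (N + 1) w (e + 2) (step e p) = σ := by
    rw [lineEnd_step.2]; exact h _ (by clear * -; revert e; decide)
  have e11 : e + 1 + 1 = e + 2 := by clear * -; revert e; decide
  have e21 : e + 2 + 1 = e + 3 := by clear * -; revert e; decide
  have m1 := hw.mono_of_ends hq (e + 1) e h1 (by rw [e11, h2]) he'
  have m2 := hw.mono_of_ends hq (e + 2) e h2 (by rw [e21, h3]) he'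
  rw [hI.sum_of_ends_but_one hw hn hp he h,
    hI.eq_of_mono_step hw hn hq (Or.inr (Or.inr ⟨m1, m2⟩))]
  ring

/-- If the neighbor toward `e` is interior, its end `e` and a side end bound a constant window of
value `-σ`, because the opposite end is `σ`. Otherwise the neighbor is the end itself. -/
theorem IncomingMessages.sum_of_ends_near {N : ℕ} {w : ℕ → ℤ} (hw : OneRunWord (N + 1) w)
    {I : ℕ → Fin 4 → ℕ × ℕ → ℤ} (hI : IncomingMessages (N + 1) w I) {σ : ℤ} {n : ℕ}
    (hn : 2 * N ≤ n) {p : ℕ × ℕ} (hp : Inside (N + 1) p) {e : Fin 4}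
    (he : lineEnd (N + 1) w e p = -σ) (h : ∀ d, d ≠ e → lineEnd (N + 1) w d p = σ)
    (hq : Inside (N + 1) (step e p) → lineEnd (N + 1) w (e + 1) (step e p) = -σ ∨
      lineEnd (N + 1) w (e + 3) (step e p) = -σ) : ∑ d, I n d p = 2 * σ := by
  rw [hI.sum_of_ends_but_one hw hn hp he h]
  suffices I n e p = -σ by rw [this]; ring
  by_cases hin : Inside (N + 1) (step e p)
  · have he' : lineEnd (N + 1) w e (step e p) = -σ := by rw [lineEnd_step.1, he]
    have h2 : lineEnd (N + 1) w (e + 2) (step e p) = - -σ := by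
      rw [lineEnd_step.2, neg_neg]; exact h _ (by clear * -; revert e; decide)
    have e31 : e + 3 + 1 = e := by clear * -; revert e; decide
    apply hI.eq_of_mono_step hw hn hin
    rcases hq hin with h1 | h3
    · exact Or.inl (hw.mono_of_ends hin e (e + 2) he' h1 h2)
    · exact Or.inr (Or.inl (hw.mono_of_ends hin (e + 3) (e + 2) h3 (by rw [e31, he']) h2))
  · rw [hI.boundary _ _ _ hp hin, he]

/-! ### Counting odd bonds line by line -/

/-- `1` if the two values differ, `0` otherwise. -/
def chg (a b : ℤ) : ℤ := if a = b then 0 else 1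

theorem chg_self (a : ℤ) : chg a a = 0 := by simp [chg]

theorem chg_nonneg (a b : ℤ) : 0 ≤ chg a b := by unfold chg; split <;> norm_num

theorem chg_of_ne {a b : ℤ} (h : a ≠ b) : chg a b = 1 := by simp [chg, h]

theorem chg_triangle (a b c : ℤ) : chg a c ≤ chg a b + chg b c := by
  unfold chg; split_ifs <;> omega

/-- The number of changes of `u` along `0, …, K`. -/
def changes (K : ℕ) (u : ℕ → ℤ) : ℤ := ∑ t ∈ Finset.range K, chg (u t) (u (t + 1))

theorem chg_le_sum_Ico (u : ℕ → ℤ) {i j : ℕ} (hij : i ≤ j) :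
    chg (u i) (u j) ≤ ∑ t ∈ Finset.Ico i j, chg (u t) (u (t + 1)) := by
  induction j, hij using Nat.le_induction with
  | base => simp [chg_self]
  | succ j hij ih =>
    rw [Finset.sum_Ico_succ_top hij]
    linarith [chg_triangle (u i) (u j) (u (j + 1))]

theorem le_changes {K : ℕ} (u : ℕ → ℤ) {i j : ℕ} (hij : i ≤ j) (hj : j ≤ K) :
    chg (u 0) (u i) + chg (u i) (u j) + chg (u j) (u K) ≤ changes K u := by
  rw [changes, Finset.range_eq_Ico, ← Finset.sum_Ico_consecutive _ (Nat.zero_le j) hj,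
    ← Finset.sum_Ico_consecutive _ (Nat.zero_le i) hij]
  linarith [chg_le_sum_Ico u (Nat.zero_le i), chg_le_sum_Ico u hij, chg_le_sum_Ico u hj]

/-- With two values available, a sequence that never returns to its first value changes at most
once. -/
theorem changes_of_no_return {K : ℕ} {u : ℕ → ℤ} (hu : ∀ t ≤ K, u t = 1 ∨ u t = -1)
    (h : ∀ i j, i < j → j ≤ K → u i ≠ u 0 → u j ≠ u 0) : changes K u = chg (u 0) (u K) := by
  induction K with
  | zero => simp [changes, chg_self]
  | succ K ih =>
    have ih := ih (fun t ht => hu t (by omega)) (fun i j hij hj => h i j hij (by omega))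
    unfold changes at ih ⊢
    rw [Finset.sum_range_succ, ih]
    have h0 := hu 0 (by omega)
    have h1 := hu K (by omega)
    have h2 := hu (K + 1) le_rfl
    have h3 := h K (K + 1) (by omega) le_rfl
    unfold chg
    split_ifs <;> omega

theorem changes_update {K : ℕ} {u : ℕ → ℤ} (hu : ∀ t, u t = 1 ∨ u t = -1) {c : ℕ} (hc : 0 < c)
    (hc' : c < K) : changes K (Function.update u c (-u c)) = changes K u +
      (1 - 2 * chg (u c) (u (c - 1))) + (1 - 2 * chg (u c) (u (c + 1))) := by
  unfold changes
  have : ∀ t ∈ Finset.range K, chg (Function.update u c (-u c) t)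
      (Function.update u c (-u c) (t + 1)) = chg (u t) (u (t + 1)) +
        (if t = c - 1 then 1 - 2 * chg (u c) (u (c - 1)) else 0) +
        (if t = c then 1 - 2 * chg (u c) (u (c + 1)) else 0) := by
    intro t _
    have h0 := hu c
    have h1 := hu (c + 1)
    have h2 := hu (c - 1)
    rcases eq_or_ne t c with rfl | hne
    · have : t ≠ t - 1 := by omega
      simp only [Function.update_self, ne_eq, Nat.succ_ne_self, not_false_eq_true,
        Function.update_of_ne, this, if_true, if_false]
      unfold chg
      split_ifs <;> omega
    · rcases eq_or_ne t (c - 1) with rfl | hne'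
      · have e : c - 1 + 1 = c := by omega
        simp only [e, Function.update_self, ne_eq, hne, not_false_eq_true, Function.update_of_ne,
          if_true, if_false]
        unfold chg
        split_ifs <;> omega
      · have : t + 1 ≠ c := by omega
        simp [hne, hne', this]
  rw [Finset.sum_congr rfl this, Finset.sum_add_distrib, Finset.sum_add_distrib,
    Finset.sum_ite_eq', Finset.sum_ite_eq', if_pos (by simp; omega), if_pos (by simpa using hc')]

/-- The number of odd bonds of the configuration `z` on `[0, K]²` that meet the interior,
counted line by line. -/
def lineCost (K : ℕ) (z : ℕ × ℕ → ℤ) : ℤ :=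
  ∑ r ∈ Finset.Ioo 0 K, changes K (fun c => z (r, c)) +
    ∑ c ∈ Finset.Ioo 0 K, changes K (fun r => z (r, c))

/-- The number of lines whose two ends have different boundary values. -/
def baseCost (K : ℕ) (w : ℕ → ℤ) : ℤ :=
  ∑ r ∈ Finset.Ioo 0 K, chg (w (3 * K + (K - r))) (w (K + r)) +
    ∑ c ∈ Finset.Ioo 0 K, chg (w c) (w (2 * K + (K - c)))

/-- The configuration `z` has boundary values given by the boundary word `w`. -/
structure Extends (K : ℕ) (w : ℕ → ℤ) (z : ℕ × ℕ → ℤ) : Prop where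
  unit : ∀ p, z p = 1 ∨ z p = -1
  top : ∀ c, 0 < c → c < K → z (0, c) = w c
  right : ∀ r, 0 < r → r < K → z (r, K) = w (K + r)
  bottom : ∀ c, 0 < c → c < K → z (K, c) = w (2 * K + (K - c))
  left : ∀ r, 0 < r → r < K → z (r, 0) = w (3 * K + (K - r))

/-- The excess of the number of changes of row `r` over its minimum. -/
def rowExcess (K : ℕ) (z : ℕ × ℕ → ℤ) (r : ℕ) : ℤ :=
  changes K (fun c => z (r, c)) - chg (z (r, 0)) (z (r, K))

/-- The excess of the number of changes of column `c` over its minimum. -/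
def colExcess (K : ℕ) (z : ℕ × ℕ → ℤ) (c : ℕ) : ℤ :=
  changes K (fun r => z (r, c)) - chg (z (0, c)) (z (K, c))

/-- The minimum of each line depends on its two ends only, so these minima add up to a quantity
determined by `w`; the nonnegative excesses carry all comparisons. -/
theorem Extends.lineCost_eq {K : ℕ} {w : ℕ → ℤ} {z : ℕ × ℕ → ℤ} (hz : Extends K w z) :
    lineCost K z = baseCost K w + ∑ r ∈ Finset.Ioo 0 K, rowExcess K z r +
      ∑ c ∈ Finset.Ioo 0 K, colExcess K z c := by
  have h1 : ∑ r ∈ Finset.Ioo 0 K, chg (z (r, 0)) (z (r, K)) =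
      ∑ r ∈ Finset.Ioo 0 K, chg (w (3 * K + (K - r))) (w (K + r)) :=
    Finset.sum_congr rfl fun r hr => by
      rw [Finset.mem_Ioo] at hr
      rw [hz.left r hr.1 hr.2, hz.right r hr.1 hr.2]
  have h2 : ∑ c ∈ Finset.Ioo 0 K, chg (z (0, c)) (z (K, c)) =
      ∑ c ∈ Finset.Ioo 0 K, chg (w c) (w (2 * K + (K - c))) :=
    Finset.sum_congr rfl fun c hc => by
      rw [Finset.mem_Ioo] at hc
      rw [hz.top c hc.1 hc.2, hz.bottom c hc.1 hc.2]
  simp only [lineCost, baseCost, rowExcess, colExcess, Finset.sum_sub_distrib, ← h1, ← h2]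
  ring

theorem le_rowExcess {K : ℕ} (z : ℕ × ℕ → ℤ) (r : ℕ) {i j : ℕ} (hij : i ≤ j) (hj : j ≤ K) :
    chg (z (r, 0)) (z (r, i)) + chg (z (r, i)) (z (r, j)) + chg (z (r, j)) (z (r, K)) -
      chg (z (r, 0)) (z (r, K)) ≤ rowExcess K z r :=
  sub_le_sub_right (le_changes (fun c => z (r, c)) hij hj) _

theorem le_colExcess {K : ℕ} (z : ℕ × ℕ → ℤ) (c : ℕ) {i j : ℕ} (hij : i ≤ j) (hj : j ≤ K) :
    chg (z (0, c)) (z (i, c)) + chg (z (i, c)) (z (j, c)) + chg (z (j, c)) (z (K, c)) -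
      chg (z (0, c)) (z (K, c)) ≤ colExcess K z c :=
  sub_le_sub_right (le_changes (fun r => z (r, c)) hij hj) _

theorem rowExcess_nonneg (K : ℕ) (z : ℕ × ℕ → ℤ) (r : ℕ) : 0 ≤ rowExcess K z r := by
  have := le_rowExcess z r (Nat.zero_le K) le_rfl
  simpa [chg_self] using this

theorem colExcess_nonneg (K : ℕ) (z : ℕ × ℕ → ℤ) (c : ℕ) : 0 ≤ colExcess K z c := by
  have := le_colExcess z c (Nat.zero_le K) le_rfl
  simpa [chg_self] using this

theorem add_le_sum_of_ne {s : Finset ℕ} {f : ℕ → ℤ} (hf : ∀ i, 0 ≤ f i) {i j : ℕ} (hi : i ∈ s)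
    (hj : j ∈ s) (hij : i ≠ j) : f i + f j ≤ ∑ t ∈ s, f t := by
  rw [← Finset.sum_pair hij]
  exact Finset.sum_le_sum_of_subset_of_nonneg (by simp [Finset.insert_subset_iff, hi, hj])
    fun t _ _ => hf t

theorem Extends.base_le {K : ℕ} {w : ℕ → ℤ} {z : ℕ × ℕ → ℤ} (hz : Extends K w z) :
    baseCost K w ≤ lineCost K z := by
  rw [hz.lineCost_eq]
  linarith [Finset.sum_nonneg fun r (_ : r ∈ Finset.Ioo 0 K) => rowExcess_nonneg K z r,
    Finset.sum_nonneg fun r (_ : r ∈ Finset.Ioo 0 K) => colExcess_nonneg K z r]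

theorem Extends.base_add_le {K : ℕ} {w : ℕ → ℤ} {z : ℕ × ℕ → ℤ} (hz : Extends K w z) {r c : ℕ}
    (hr : r ∈ Finset.Ioo 0 K) (hc : c ∈ Finset.Ioo 0 K) :
    baseCost K w + rowExcess K z r + colExcess K z c ≤ lineCost K z := by
  rw [hz.lineCost_eq]
  linarith [Finset.single_le_sum (fun r _ => rowExcess_nonneg K z r) hr,
    Finset.single_le_sum (fun r _ => colExcess_nonneg K z r) hc]

theorem Extends.base_add_rows_le {K : ℕ} {w : ℕ → ℤ} {z : ℕ × ℕ → ℤ} (hz : Extends K w z)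
    {r r' : ℕ} (hr : r ∈ Finset.Ioo 0 K) (hr' : r' ∈ Finset.Ioo 0 K) (hne : r ≠ r') :
    baseCost K w + rowExcess K z r + rowExcess K z r' ≤ lineCost K z := by
  rw [hz.lineCost_eq]
  linarith [add_le_sum_of_ne (rowExcess_nonneg K z) hr hr' hne,
    Finset.sum_nonneg fun r (_ : r ∈ Finset.Ioo 0 K) => colExcess_nonneg K z r]

theorem Extends.base_add_cols_le {K : ℕ} {w : ℕ → ℤ} {z : ℕ × ℕ → ℤ} (hz : Extends K w z)
    {c c' : ℕ} (hc : c ∈ Finset.Ioo 0 K) (hc' : c' ∈ Finset.Ioo 0 K) (hne : c ≠ c') :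
    baseCost K w + colExcess K z c + colExcess K z c' ≤ lineCost K z := by
  rw [hz.lineCost_eq]
  linarith [add_le_sum_of_ne (colExcess_nonneg K z) hc hc' hne,
    Finset.sum_nonneg fun r (_ : r ∈ Finset.Ioo 0 K) => rowExcess_nonneg K z r]

theorem lineCost_flip {K : ℕ} {z : ℕ × ℕ → ℤ} (hz : ∀ p, z p = 1 ∨ z p = -1) {p : ℕ × ℕ}
    (hp : Inside K p) : lineCost K (Function.update z p (-z p)) =
      lineCost K z + ∑ d, (1 - 2 * chg (z p) (z (step d p))) := by
  obtain ⟨r, c⟩ := p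
  obtain ⟨hr, hr', hc, hc'⟩ := hp
  simp only at hr hr' hc hc'
  have h1 : ∀ r' ∈ Finset.Ioo 0 K,
      changes K (fun c' => Function.update z (r, c) (-z (r, c)) (r', c')) =
        changes K (fun c' => z (r', c')) + if r' = r then (1 - 2 * chg (z (r, c)) (z (r, c - 1))) +
          (1 - 2 * chg (z (r, c)) (z (r, c + 1))) else 0 := by
    intro r' _
    split_ifs with h
    · subst h
      rw [← add_assoc, ← changes_update (u := fun c' => z (r', c')) (fun t => hz _) hc hc']
      congr 1
      ext c'
      by_cases h : c' = c <;> simp [h]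
    · simp [h]
  have h2 : ∀ c' ∈ Finset.Ioo 0 K,
      changes K (fun r' => Function.update z (r, c) (-z (r, c)) (r', c')) =
        changes K (fun r' => z (r', c')) + if c' = c then (1 - 2 * chg (z (r, c)) (z (r - 1, c))) +
          (1 - 2 * chg (z (r, c)) (z (r + 1, c))) else 0 := by
    intro c' _
    split_ifs with h
    · subst h
      rw [← add_assoc, ← changes_update (u := fun r' => z (r', c')) (fun t => hz _) hr hr']
      congr 1
      ext r'
      by_cases h : r' = r <;> simp [h]
    · simp [h]
  rw [lineCost, Finset.sum_congr rfl h1, Finset.sum_congr rfl h2, Finset.sum_add_distrib,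
    Finset.sum_add_distrib, Finset.sum_ite_eq', Finset.sum_ite_eq',
    if_pos (Finset.mem_Ioo.2 ⟨hr, hr'⟩), if_pos (Finset.mem_Ioo.2 ⟨hc, hc'⟩), Fin.sum_univ_four,
    lineCost]
  simp only [step]
  ring

theorem Extends.flip {K : ℕ} {w : ℕ → ℤ} {z : ℕ × ℕ → ℤ} (hz : Extends K w z) {p : ℕ × ℕ}
    (hp : Inside K p) : Extends K w (Function.update z p (-z p)) := by
  obtain ⟨r, c⟩ := p
  obtain ⟨hr, hr', hc, hc'⟩ := hp
  simp only at hr hr' hc hc'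
  refine ⟨fun q => ?_, fun i h h' => ?_, fun i h h' => ?_, fun i h h' => ?_, fun i h h' => ?_⟩
  · rw [Function.update_apply]
    have := hz.unit (r, c)
    have := hz.unit q
    split_ifs <;> omega
  all_goals rw [Function.update_of_ne (by simp only [ne_eq, Prod.mk.injEq]; omega)]
  exacts [hz.top i h h', hz.right i h h', hz.bottom i h h', hz.left i h h']

/-! ### A configuration minimizing every line at once -/

/-- The configuration whose value at an interior site is the sign of the sum of the line ends,
ties being broken by `τ`. -/
def lineMajority (K : ℕ) (w : ℕ → ℤ) (z : ℕ × ℕ → ℤ) (τ : ℤ) (p : ℕ × ℕ) : ℤ :=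
  if 0 < p.1 ∧ p.1 < K ∧ 0 < p.2 ∧ p.2 < K then Int.sign (∑ d, lineEnd K w d p + τ) else z p

theorem lineMajority_inside {K : ℕ} {w : ℕ → ℤ} {z : ℕ × ℕ → ℤ} {τ : ℤ} {p : ℕ × ℕ}
    (hp : Inside K p) : lineMajority K w z τ p = Int.sign (∑ d, lineEnd K w d p + τ) := if_pos hp

theorem sign_cases (a : ℤ) : (0 < a ∧ Int.sign a = 1) ∨ (a = 0 ∧ Int.sign a = 0) ∨
    (a < 0 ∧ Int.sign a = -1) := by
  rcases lt_trichotomy a 0 with h | h | h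
  · exact Or.inr (Or.inr ⟨h, Int.sign_eq_neg_one_of_neg h⟩)
  · exact Or.inr (Or.inl ⟨h, by simp [h]⟩)
  · exact Or.inl ⟨h, Int.sign_eq_one_of_pos h⟩

theorem Extends.lineMajority {K : ℕ} {w : ℕ → ℤ} {z : ℕ × ℕ → ℤ} (hw : OneRunWord K w)
    (hz : Extends K w z) {τ : ℤ} (hτ : τ = 1 ∨ τ = -1) :
    Extends K w (lineMajority K w z τ) := by
  refine ⟨fun q => ?_, fun i h h' => ?_, fun i h h' => ?_, fun i h h' => ?_, fun i h h' => ?_⟩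
  · unfold BlockInterp.lineMajority
    split_ifs
    · have hu : ∀ d, lineEnd K w d q = 1 ∨ lineEnd K w d q = -1 := fun d => hw.unit _
      rw [Fin.sum_univ_four]
      -- The sum of four odd ends is even, so adding the odd `τ` never gives zero.
      have := sign_cases (lineEnd K w 0 q + lineEnd K w 1 q + lineEnd K w 2 q +
        lineEnd K w 3 q + τ)
      have := hu 0
      have := hu 1
      have := hu 2
      have := hu 3
      omega
    · exact hz.unit q
  all_goals rw [BlockInterp.lineMajority, if_neg (by simp only; omega)]
  exacts [hz.top i h h', hz.right i h h', hz.bottom i h h', hz.left i h h']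

/-- Suppose the left end is `σ` and site `i` has value `-σ`. Then the right end is `-σ`, since
otherwise the four ends alternate, and the top or bottom end of column `i` is `-σ`. Non-alternation
carries such an end over to every column `j` further right, so the votes for `-σ` persist and the
row never returns to `σ`. -/
theorem rowExcess_lineMajority {K : ℕ} {w : ℕ → ℤ} {z : ℕ × ℕ → ℤ} (hw : OneRunWord K w)
    (hz : Extends K w z) {τ : ℤ} (hτ : τ = 1 ∨ τ = -1) {r : ℕ} (hr : 0 < r) (hr' : r < K) :
    rowExcess K (lineMajority K w z τ) r = 0 := by
  have hx := hz.lineMajority hw hτ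
  rw [rowExcess, sub_eq_zero]
  refine changes_of_no_return (fun t _ => hx.unit _) fun i j hij hj hi hj0 => ?_
  have hL := hx.left r hr hr'
  have hR := hx.right r hr hr'
  have hi0 : 0 < i := by
    rcases Nat.eq_zero_or_pos i with rfl | h
    · exact absurd rfl hi
    · exact h
  rw [hL] at hi hj0
  rw [lineMajority_inside (p := (r, i)) ⟨hr, hr', hi0, by simp only; omega⟩, Fin.sum_univ_four] at hi
  simp only [lineEnd, gap] at hi
  simp at hi
  have hs := sign_cases (w i + w (K + r) + w (2 * K + (K - i)) + w (3 * K + (K - r)) + τ)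
  have u1 := hw.unit i
  have u2 := hw.unit (K + r)
  have u3 := hw.unit (2 * K + (K - i))
  have u4 := hw.unit (3 * K + (K - r))
  have n1 := hw.noAlt i (K + r) (2 * K + (K - i)) (3 * K + (K - r)) (by omega) (by omega)
    (by omega) (by omega) (by omega)
  rcases Nat.lt_or_ge j K with hjK | hjK
  · rw [lineMajority_inside (p := (r, j)) ⟨hr, hr', by simp only; omega, hjK⟩,
      Fin.sum_univ_four] at hj0
    simp only [lineEnd, gap] at hj0
    simp at hj0
    have hs' := sign_cases (w j + w (K + r) + w (2 * K + (K - j)) + w (3 * K + (K - r)) + τ)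
    have v1 := hw.unit j
    have v3 := hw.unit (2 * K + (K - j))
    have n2 := hw.noAlt i j (K + r) (3 * K + (K - r)) (by omega) (by omega)
      (by omega) (by omega) (by omega)
    have n3 := hw.noAlt (K + r) (2 * K + (K - j)) (2 * K + (K - i)) (3 * K + (K - r)) (by omega)
      (by omega) (by omega) (by omega) (by omega)
    omega
  · obtain rfl : j = K := by omega
    omega

theorem colExcess_lineMajority {K : ℕ} {w : ℕ → ℤ} {z : ℕ × ℕ → ℤ} (hw : OneRunWord K w)
    (hz : Extends K w z) {τ : ℤ} (hτ : τ = 1 ∨ τ = -1) {c : ℕ} (hc : 0 < c) (hc' : c < K) :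
    colExcess K (lineMajority K w z τ) c = 0 := by
  have hx := hz.lineMajority hw hτ
  rw [colExcess, sub_eq_zero]
  refine changes_of_no_return (fun t _ => hx.unit _) fun i j hij hj hi hj0 => ?_
  have hT := hx.top c hc hc'
  have hB := hx.bottom c hc hc'
  have hi0 : 0 < i := by
    rcases Nat.eq_zero_or_pos i with rfl | h
    · exact absurd rfl hi
    · exact h
  rw [hT] at hi hj0
  rw [lineMajority_inside (p := (i, c)) ⟨hi0, by simp only; omega, hc, hc'⟩, Fin.sum_univ_four] at hi
  simp only [lineEnd, gap] at hi
  simp at hi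
  have hs := sign_cases (w c + w (K + i) + w (2 * K + (K - c)) + w (3 * K + (K - i)) + τ)
  have u1 := hw.unit c
  have u2 := hw.unit (K + i)
  have u3 := hw.unit (2 * K + (K - c))
  have u4 := hw.unit (3 * K + (K - i))
  have n1 := hw.noAlt c (K + i) (2 * K + (K - c)) (3 * K + (K - i)) (by omega) (by omega)
    (by omega) (by omega) (by omega)
  rcases Nat.lt_or_ge j K with hjK | hjK
  · rw [lineMajority_inside (p := (j, c)) ⟨by simp only; omega, hjK, hc, hc'⟩,
      Fin.sum_univ_four] at hj0
    simp only [lineEnd, gap] at hj0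
    simp at hj0
    have hs' := sign_cases (w c + w (K + j) + w (2 * K + (K - c)) + w (3 * K + (K - j)) + τ)
    have v1 := hw.unit (K + j)
    have v3 := hw.unit (3 * K + (K - j))
    have n2 := hw.noAlt c (K + i) (K + j) (2 * K + (K - c)) (by omega) (by omega)
      (by omega) (by omega) (by omega)
    have n3 := hw.noAlt c (2 * K + (K - c)) (3 * K + (K - j)) (3 * K + (K - i)) (by omega)
      (by omega) (by omega) (by omega) (by omega)
    omega
  · obtain rfl : j = K := by omega
    omega

theorem lineCost_lineMajority {K : ℕ} {w : ℕ → ℤ} {z : ℕ × ℕ → ℤ} (hw : OneRunWord K w)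
    (hz : Extends K w z) {τ : ℤ} (hτ : τ = 1 ∨ τ = -1) :
    lineCost K (lineMajority K w z τ) = baseCost K w := by
  rw [(hz.lineMajority hw hτ).lineCost_eq, Finset.sum_eq_zero, Finset.sum_eq_zero]
  · ring
  · intro c hc
    rw [Finset.mem_Ioo] at hc
    exact colExcess_lineMajority hw hz hτ hc.1 hc.2
  · intro r hr
    rw [Finset.mem_Ioo] at hr
    exact rowExcess_lineMajority hw hz hτ hr.1 hr.2

/-! ### Minimal costs with a prescribed value at one site -/

/-- `m` is the minimal cost of a configuration with value `s` at `p` and boundary word `w`. -/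
def IsMinCost (K : ℕ) (w : ℕ → ℤ) (p : ℕ × ℕ) (s m : ℤ) : Prop :=
  (∃ z, Extends K w z ∧ z p = s ∧ lineCost K z ≤ m) ∧
    ∀ z, Extends K w z → z p = s → m ≤ lineCost K z

theorem isMinCost_base {K : ℕ} {w : ℕ → ℤ} {z : ℕ × ℕ → ℤ} (hw : OneRunWord K w)
    (hz : Extends K w z) {p : ℕ × ℕ} {τ σ : ℤ} (hτ : τ = 1 ∨ τ = -1)
    (h : lineMajority K w z τ p = σ) : IsMinCost K w p σ (baseCost K w) :=
  ⟨⟨_, hz.lineMajority hw hτ, h, (lineCost_lineMajority hw hz hτ).le⟩, fun _ hy _ => hy.base_le⟩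

theorem lineMajority_eq {K : ℕ} {w : ℕ → ℤ} {z : ℕ × ℕ → ℤ} {p : ℕ × ℕ} (hp : Inside K p)
    {τ σ : ℤ} (hσ : σ = 1 ∨ σ = -1) (h : 0 < σ * (∑ d, lineEnd K w d p + τ)) :
    lineMajority K w z τ p = σ := by
  rw [lineMajority_inside hp]
  rcases hσ with rfl | rfl
  · exact Int.sign_eq_one_of_pos (by omega)
  · exact Int.sign_eq_neg_one_of_neg (by omega)

theorem sum_lineEnd_but_one {K : ℕ} {w : ℕ → ℤ} {p : ℕ × ℕ} {σ : ℤ} {e : Fin 4}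
    (he : lineEnd K w e p = -σ) (h : ∀ d, d ≠ e → lineEnd K w d p = σ) :
    ∑ d, lineEnd K w d p = 2 * σ := by
  rw [sum_directions _ e, he, h _ (by clear * -; revert e; decide),
    h _ (by clear * -; revert e; decide), h _ (by clear * -; revert e; decide)]
  ring

theorem exists_flip_le {K : ℕ} {w : ℕ → ℤ} {z : ℕ × ℕ → ℤ} (hz : Extends K w z) {p : ℕ × ℕ}
    (hp : Inside K p) {σ m : ℤ} (h : z p = σ)
    (hm : lineCost K z + ∑ d, (1 - 2 * chg (z p) (z (step d p))) ≤ m) :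
    ∃ y, Extends K w y ∧ y p = -σ ∧ lineCost K y ≤ m :=
  ⟨_, hz.flip hp, by simp [h], (lineCost_flip hz.unit hp).trans_le hm⟩

/-- Flipping `p` in the majority configuration costs at most one per bond, hence at most 4; only the
lower bound remains to be supplied. -/
theorem isMinCost_of_base_add_four_le {K : ℕ} {w : ℕ → ℤ} {z : ℕ × ℕ → ℤ} (hw : OneRunWord K w)
    (hz : Extends K w z) {p : ℕ × ℕ} (hp : Inside K p) {σ : ℤ} (hσ : σ = 1 ∨ σ = -1)
    (h : 0 < σ * (∑ d, lineEnd K w d p + σ))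
    (hle : ∀ y, Extends K w y → y p = -σ → baseCost K w + 4 ≤ lineCost K y) :
    IsMinCost K w p σ (baseCost K w) ∧ IsMinCost K w p (-σ) (baseCost K w + 4) := by
  have hx := lineMajority_eq (z := z) hp hσ h
  refine ⟨isMinCost_base hw hz hσ hx, exists_flip_le (hz.lineMajority hw hσ) hp hx ?_, hle⟩
  rw [lineCost_lineMajority hw hz hσ, Fin.sum_univ_four]
  linarith [chg_nonneg (lineMajority K w z σ p) (lineMajority K w z σ (step 0 p)),
    chg_nonneg (lineMajority K w z σ p) (lineMajority K w z σ (step 1 p)),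
    chg_nonneg (lineMajority K w z σ p) (lineMajority K w z σ (step 2 p)),
    chg_nonneg (lineMajority K w z σ p) (lineMajority K w z σ (step 3 p))]

/-- The row leaves `σ` and returns to it, while its equal ends require no change. -/
theorem Extends.row_le {K : ℕ} {w : ℕ → ℤ} {z : ℕ × ℕ → ℤ} (hz : Extends K w z) {p : ℕ × ℕ}
    (hp : Inside K p) {σ : ℤ} (hσ : σ = 1 ∨ σ = -1) (h : z p = -σ)
    (h1 : lineEnd K w 1 p = σ) (h3 : lineEnd K w 3 p = σ) : 2 ≤ rowExcess K z p.1 := by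
  obtain ⟨r, c⟩ := p
  obtain ⟨hr, hr', hc, hc'⟩ := hp
  simp only at hr hr' hc hc'
  have := le_rowExcess z r (le_refl c) hc'.le
  have hL := hz.left r hr hr'
  have hR := hz.right r hr hr'
  simp [lineEnd, gap] at h1 h3
  rw [hL, hR, h, h1, h3, chg_self, chg_self, chg_of_ne (by omega), chg_of_ne (by omega)] at this
  simpa using this

theorem Extends.col_le {K : ℕ} {w : ℕ → ℤ} {z : ℕ × ℕ → ℤ} (hz : Extends K w z) {p : ℕ × ℕ}
    (hp : Inside K p) {σ : ℤ} (hσ : σ = 1 ∨ σ = -1) (h : z p = -σ)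
    (h0 : lineEnd K w 0 p = σ) (h2 : lineEnd K w 2 p = σ) : 2 ≤ colExcess K z p.2 := by
  obtain ⟨r, c⟩ := p
  obtain ⟨hr, hr', hc, hc'⟩ := hp
  simp only at hr hr' hc hc'
  have := le_colExcess z c (le_refl r) hr'.le
  have hL := hz.top c hc hc'
  have hR := hz.bottom c hc hc'
  simp [lineEnd, gap] at h0 h2
  rw [hL, hR, h, h0, h2, chg_self, chg_self, chg_of_ne (by omega), chg_of_ne (by omega)] at this
  simpa using this

theorem Inside.row_mem {K : ℕ} {p : ℕ × ℕ} (hp : Inside K p) : p.1 ∈ Finset.Ioo 0 K :=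
  Finset.mem_Ioo.2 ⟨hp.1, hp.2.1⟩

theorem Inside.col_mem {K : ℕ} {p : ℕ × ℕ} (hp : Inside K p) : p.2 ∈ Finset.Ioo 0 K :=
  Finset.mem_Ioo.2 hp.2.2

theorem isMinCost_of_ends_eq {K : ℕ} {w : ℕ → ℤ} {z : ℕ × ℕ → ℤ} (hw : OneRunWord K w)
    (hz : Extends K w z) {p : ℕ × ℕ} (hp : Inside K p) {σ : ℤ} (hσ : σ = 1 ∨ σ = -1)
    (h : ∀ d, lineEnd K w d p = σ) :
    IsMinCost K w p σ (baseCost K w) ∧ IsMinCost K w p (-σ) (baseCost K w + 4) := by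
  apply isMinCost_of_base_add_four_le hw hz hp hσ
  · rw [Fin.sum_univ_four, h, h, h, h]
    rcases hσ with rfl | rfl <;> norm_num
  · intro y hy hyp
    linarith [hy.base_add_le hp.row_mem hp.col_mem, hy.row_le hp hσ hyp (h 1) (h 3),
      hy.col_le hp hσ hyp (h 0) (h 2)]

/-- The ends tie, so the two tie-breaks realize both values at the base cost. -/
theorem isMinCost_of_ends_pairs {K : ℕ} {w : ℕ → ℤ} {z : ℕ × ℕ → ℤ} (hw : OneRunWord K w)
    (hz : Extends K w z) {p : ℕ × ℕ} (hp : Inside K p) {σ : ℤ} (hσ : σ = 1 ∨ σ = -1) {k : Fin 4}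
    (h0 : lineEnd K w k p = σ) (h1 : lineEnd K w (k + 1) p = σ)
    (h2 : lineEnd K w (k + 2) p = -σ) (h3 : lineEnd K w (k + 3) p = -σ) :
    IsMinCost K w p σ (baseCost K w) ∧ IsMinCost K w p (-σ) (baseCost K w) := by
  have hs : ∑ d, lineEnd K w d p = 0 := by rw [sum_directions _ k, h0, h1, h2, h3]; ring
  have hσ' : -σ = 1 ∨ -σ = -1 := by omega
  constructor
  · refine isMinCost_base hw hz hσ (lineMajority_eq hp hσ ?_)
    rw [hs]; rcases hσ with rfl | rfl <;> norm_num
  · refine isMinCost_base hw hz hσ' (lineMajority_eq hp hσ' ?_)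
    rw [hs]; rcases hσ with rfl | rfl <;> norm_num

/-- Break ties toward `-σ`. Then the neighbor toward `e` has value `-σ` while `p` keeps `σ`, so
flipping `p` gains one bond and loses at most three. The line through `p` perpendicular to `e` has
equal ends and forces the excess 2. -/
theorem isMinCost_of_ends_near {K : ℕ} {w : ℕ → ℤ} {z : ℕ × ℕ → ℤ} (hw : OneRunWord K w)
    (hz : Extends K w z) {p : ℕ × ℕ} (hp : Inside K p) {σ : ℤ} (hσ : σ = 1 ∨ σ = -1) {e : Fin 4}
    (he : lineEnd K w e p = -σ) (h : ∀ d, d ≠ e → lineEnd K w d p = σ)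
    (hq : Inside K (step e p) → lineEnd K w (e + 1) (step e p) = -σ ∨
      lineEnd K w (e + 3) (step e p) = -σ) :
    IsMinCost K w p σ (baseCost K w) ∧ IsMinCost K w p (-σ) (baseCost K w + 2) := by
  have hs := sum_lineEnd_but_one he h
  have hσ' : -σ = 1 ∨ -σ = -1 := by omega
  have hx : lineMajority K w z (-σ) p = σ := lineMajority_eq hp hσ (by
    rw [hs]; rcases hσ with rfl | rfl <;> norm_num)
  refine ⟨isMinCost_base hw hz hσ' hx, exists_flip_le (hz.lineMajority hw hσ') hp hx ?_, ?_⟩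
  · have hstep : lineMajority K w z (-σ) (step e p) = -σ := by
      by_cases hin : Inside K (step e p)
      · apply lineMajority_eq hin hσ'
        have e0 := lineEnd_step (K := K) (w := w) (p := p) (d := e)
        rw [he, h (e + 2) (by clear * -; revert e; decide)] at e0
        have u1 : lineEnd K w (e + 1) (step e p) = 1 ∨ lineEnd K w (e + 1) (step e p) = -1 :=
          hw.unit _
        have u3 : lineEnd K w (e + 3) (step e p) = 1 ∨ lineEnd K w (e + 3) (step e p) = -1 :=
          hw.unit _
        have := hq hin
        rw [sum_directions _ e, e0.1, e0.2]
        rcases hσ with rfl | rfl <;> omega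
      · have hy := hz.lineMajority hw hσ'
        refine Eq.trans ?_ he
        obtain ⟨r, c⟩ := p
        obtain ⟨hr, hr', hc, hc'⟩ := hp
        simp only at hr hr' hc hc'
        fin_cases e <;> simp [step, Inside] at hin <;> simp [step, lineEnd, gap]
        · obtain rfl : r = 1 := by omega
          exact hy.top c hc hc'
        · obtain rfl : K = c + 1 := by omega
          exact hy.right r hr hr'
        · obtain rfl : K = r + 1 := by omega
          exact hy.bottom c hc hc'
        · obtain rfl : c = 1 := by omega
          exact hy.left r hr hr'
    rw [lineCost_lineMajority hw hz hσ', sum_directions _ e, hstep, hx,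
      chg_of_ne (show σ ≠ -σ by omega)]
    linarith [chg_nonneg σ (lineMajority K w z (-σ) (step (e + 1) p)),
      chg_nonneg σ (lineMajority K w z (-σ) (step (e + 2) p)),
      chg_nonneg σ (lineMajority K w z (-σ) (step (e + 3) p))]
  · intro y hy hyp
    have hle := hy.base_add_le hp.row_mem hp.col_mem
    have := rowExcess_nonneg K y p.1
    have := colExcess_nonneg K y p.2
    by_cases hev : e = 0 ∨ e = 2
    · have := hy.row_le hp hσ hyp (h 1 (by rcases hev with rfl | rfl <;> decide))
        (h 3 (by rcases hev with rfl | rfl <;> decide))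
      linarith
    · push Not at hev
      have := hy.col_le hp hσ hyp (h 0 hev.1.symm) (h 2 hev.2.symm)
      linarith

/-- The line through `p` perpendicular to `e` has excess 2. A second excess 2 depends on the
neighbor toward `e`: if it is `-σ`, its own perpendicular line has ends `σ`; if it is `σ`, the line
along `e` reads `-σ, σ, -σ, σ`, three changes where one is needed. -/
theorem isMinCost_of_ends_far {K : ℕ} {w : ℕ → ℤ} {z : ℕ × ℕ → ℤ} (hw : OneRunWord K w)
    (hz : Extends K w z) {p : ℕ × ℕ} (hp : Inside K p) {σ : ℤ} (hσ : σ = 1 ∨ σ = -1) {e : Fin 4}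
    (he : lineEnd K w e p = -σ) (h : ∀ d, d ≠ e → lineEnd K w d p = σ)
    (hq : Inside K (step e p)) (h1 : lineEnd K w (e + 1) (step e p) = σ)
    (h3 : lineEnd K w (e + 3) (step e p) = σ) :
    IsMinCost K w p σ (baseCost K w) ∧ IsMinCost K w p (-σ) (baseCost K w + 4) := by
  apply isMinCost_of_base_add_four_le hw hz hp hσ
  · rw [sum_lineEnd_but_one he h]
    rcases hσ with rfl | rfl <;> norm_num
  intro y hy hyp
  have hle := hy.base_add_le hp.row_mem hp.col_mem
  have hopp := h (e + 2) (by clear * -; revert e; decide)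
  have hne : σ ≠ -σ := by omega
  have hcases : y (step e p) = -σ ∨ y (step e p) = σ := by have := hy.unit (step e p); omega
  have hrow : e = 0 ∨ e = 2 → 2 ≤ rowExcess K y p.1 := fun hev =>
    hy.row_le hp hσ hyp (h 1 (by rcases hev with rfl | rfl <;> decide))
      (h 3 (by rcases hev with rfl | rfl <;> decide))
  have hcol : e = 1 ∨ e = 3 → 2 ≤ colExcess K y p.2 := fun hev =>
    hy.col_le hp hσ hyp (h 0 (by rcases hev with rfl | rfl <;> decide))
      (h 2 (by rcases hev with rfl | rfl <;> decide))
  have hT := hy.top p.2 hp.2.2.1 hp.2.2.2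
  have hB := hy.bottom p.2 hp.2.2.1 hp.2.2.2
  have hL := hy.left p.1 hp.1 hp.2.1
  have hR := hy.right p.1 hp.1 hp.2.1
  have e1 : chg σ (-σ) = 1 := chg_of_ne hne
  have e2 : chg (-σ) σ = 1 := chg_of_ne hne.symm
  obtain ⟨r, c⟩ := p
  obtain ⟨hr, hr', hc, hc'⟩ := id hp
  simp only at hr hr' hc hc' hle hrow hcol hT hB hL hR
  fin_cases e
  · have hrow := hrow (by decide)
    rcases hcases with hs | hs
    · have := hy.row_le hq hσ hs h1 h3
      have := hy.base_add_rows_le hp.row_mem hq.row_mem (by simp [step]; omega)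
      linarith
    · simp [step, lineEnd, gap] at hs he hopp
      have := le_colExcess y c (show r - 1 ≤ r by omega) hr'.le
      rw [hs, hyp, hT, hB, he, hopp, e1, e2] at this
      linarith
  · have hcol := hcol (by decide)
    rcases hcases with hs | hs
    · have := hy.col_le hq hσ hs h3 h1
      have := hy.base_add_cols_le hp.col_mem hq.col_mem (by simp [step])
      linarith
    · simp [step, lineEnd, gap] at hs he hopp
      have := le_rowExcess y r (show c ≤ c + 1 by omega) hc'
      rw [hs, hyp, hL, hR, he, hopp, e1, e2] at this
      linarith
  · have hrow := hrow (by decide)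
    rcases hcases with hs | hs
    · have := hy.row_le hq hσ hs h3 h1
      have := hy.base_add_rows_le hp.row_mem hq.row_mem (by simp [step])
      linarith
    · simp [step, lineEnd, gap] at hs he hopp
      have := le_colExcess y c (show r ≤ r + 1 by omega) hr'
      rw [hs, hyp, hT, hB, he, hopp, e1, e2] at this
      linarith
  · have hcol := hcol (by decide)
    rcases hcases with hs | hs
    · have := hy.col_le hq hσ hs h1 h3
      have := hy.base_add_cols_le hp.col_mem hq.col_mem (by simp [step]; omega)
      linarith
    · simp [step, lineEnd, gap] at hs he hopp
      have := le_rowExcess y r (show c - 1 ≤ c by omega) hc'.le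
      rw [hs, hyp, hL, hR, he, hopp, e1, e2] at this
      linarith

/-- The limit of the sum of the incoming messages is the difference of the minimal costs. -/
theorem IncomingMessages.sum_eq_sub_minCost {N : ℕ} {w : ℕ → ℤ} (hw : OneRunWord (N + 1) w)
    {I : ℕ → Fin 4 → ℕ × ℕ → ℤ} (hI : IncomingMessages (N + 1) w I) {z : ℕ × ℕ → ℤ}
    (hz : Extends (N + 1) w z) {n : ℕ} (hn : 2 * N ≤ n) {p : ℕ × ℕ} (hp : Inside (N + 1) p) :
    ∃ a b : ℤ, IsMinCost (N + 1) w p (-1) a ∧ IsMinCost (N + 1) w p 1 b ∧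
      ∑ d, I n d p = a - b := by
  -- All patterns are stated up to the sign `σ`; for `σ = -1` the two costs exchange roles, which
  -- the factor `σ` records.
  have key : ∀ σ m : ℤ, (σ = 1 ∨ σ = -1) → IsMinCost (N + 1) w p σ (baseCost (N + 1) w) ∧
      IsMinCost (N + 1) w p (-σ) (baseCost (N + 1) w + m) → ∑ d, I n d p = m * σ →
      ∃ a b : ℤ, IsMinCost (N + 1) w p (-1) a ∧ IsMinCost (N + 1) w p 1 b ∧
        ∑ d, I n d p = a - b := by
    rintro σ m (rfl | rfl) ⟨h1, h2⟩ h3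
    · exact ⟨_, _, h2, h1, by rw [h3]; ring⟩
    · exact ⟨_, _, h1, h2, by rw [h3]; ring⟩
  obtain ⟨σ, hσ, h | ⟨e, he, h⟩ | ⟨k, h0, h1, h2, h3⟩⟩ := hw.ends_cases hp
  · exact key σ 4 hσ (isMinCost_of_ends_eq hw hz hp hσ h) (hI.sum_of_ends_eq hw hn hp h)
  · by_cases hq : Inside (N + 1) (step e p) ∧ lineEnd (N + 1) w (e + 1) (step e p) = σ ∧
      lineEnd (N + 1) w (e + 3) (step e p) = σ
    · obtain ⟨hq, h1, h3⟩ := hq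
      exact key σ 4 hσ (isMinCost_of_ends_far hw hz hp hσ he h hq h1 h3)
        (hI.sum_of_ends_far hw hn hp he h hq h1 h3)
    · have hq' : Inside (N + 1) (step e p) → lineEnd (N + 1) w (e + 1) (step e p) = -σ ∨
          lineEnd (N + 1) w (e + 3) (step e p) = -σ := by
        intro hin
        have u1 : lineEnd (N + 1) w (e + 1) (step e p) = 1 ∨
          lineEnd (N + 1) w (e + 1) (step e p) = -1 := hw.unit _
        have u3 : lineEnd (N + 1) w (e + 3) (step e p) = 1 ∨
          lineEnd (N + 1) w (e + 3) (step e p) = -1 := hw.unit _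
        by_contra hcon
        exact hq ⟨hin, by omega, by omega⟩
      exact key σ 2 hσ (isMinCost_of_ends_near hw hz hp hσ he h hq')
        (hI.sum_of_ends_near hw hn hp he h hq')
  · exact key σ 0 hσ (by simpa using isMinCost_of_ends_pairs hw hz hp hσ h0 h1 h2 h3)
      (by simpa using hI.sum_of_ends_pairs hw hn hp h0 h1 h2 h3)

/-! ### The grid graph in coordinates -/

/-- The site with coordinates `p`. -/
def site (N : ℕ) (p : ℕ × ℕ) : Site N := (Fin.ofNat (N + 2) p.1, Fin.ofNat (N + 2) p.2)

/-- The coordinates of a site. -/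
def coord {N : ℕ} (v : Site N) : ℕ × ℕ := (v.1.val, v.2.val)

theorem site_coord {N : ℕ} (v : Site N) : site N (coord v) = v := by
  obtain ⟨a, b⟩ := v
  simp [site, coord]

theorem coord_site {N : ℕ} {p : ℕ × ℕ} (h1 : p.1 ≤ N + 1) (h2 : p.2 ≤ N + 1) :
    coord (site N p) = p := by
  obtain ⟨a, b⟩ := p
  simp only at h1 h2
  simp only [site, coord, Fin.ofNat, Prod.mk.injEq]
  exact ⟨Nat.mod_eq_of_lt (by omega), Nat.mod_eq_of_lt (by omega)⟩

theorem coord_le {N : ℕ} (v : Site N) : (coord v).1 ≤ N + 1 ∧ (coord v).2 ≤ N + 1 := by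
  obtain ⟨a, b⟩ := v
  exact ⟨by have := a.2; simp only [coord]; omega, by have := b.2; simp only [coord]; omega⟩

theorem adj_iff_coord {N : ℕ} (u v : Site N) : (grid N).Adj u v ↔
    ((coord u).2 = (coord v).2 ∧
      ((coord u).1 + 1 = (coord v).1 ∨ (coord v).1 + 1 = (coord u).1)) ∨
    ((coord u).1 = (coord v).1 ∧
      ((coord u).2 + 1 = (coord v).2 ∨ (coord v).2 + 1 = (coord u).2)) := by
  simp only [grid, coord, Fin.ext_iff]

theorem adj_iff_step {N : ℕ} (u v : Site N) : (grid N).Adj u v ↔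
    ∃ d, 0 < gap (N + 1) d (coord u) ∧ coord v = step d (coord u) := by
  rw [adj_iff_coord]
  have h1 := coord_le u
  have h2 := coord_le v
  generalize coord u = p at *
  generalize coord v = q at *
  obtain ⟨a, b⟩ := p
  obtain ⟨c, d⟩ := q
  simp only [Fin.exists_fin_succ]
  simp [gap, step] at h1 h2 ⊢
  omega

theorem step_le {N : ℕ} {p : ℕ × ℕ} (h1 : p.1 ≤ N + 1) (h2 : p.2 ≤ N + 1) {d : Fin 4}
    (hd : 0 < gap (N + 1) d p) : (step d p).1 ≤ N + 1 ∧ (step d p).2 ≤ N + 1 := by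
  obtain ⟨a, b⟩ := p
  fin_cases d <;> simp [gap, step] at hd h1 h2 ⊢ <;> omega

/-- The restriction to positive gaps matters: at a side, truncated subtraction makes `step` stay
put, and `site` reduces coordinates modulo `N + 2`. -/
theorem step_injOn {N : ℕ} (v : Site N) : Set.InjOn (fun d => site N (step d (coord v)))
    {d | 0 < gap (N + 1) d (coord v)} := by
  intro d hd e he hde
  have hv := coord_le v
  have hd' := step_le hv.1 hv.2 hd
  have he' := step_le hv.1 hv.2 he
  have := congrArg coord hde
  simp only [coord_site hd'.1 hd'.2, coord_site he'.1 he'.2] at this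
  simp only [Set.mem_ofPred_eq] at hd he
  generalize coord v = p at *
  obtain ⟨a, b⟩ := p
  fin_cases d <;> fin_cases e <;> simp [step, gap] at this hd he ⊢ <;> omega

theorem neighborFinset_eq {N : ℕ} (v : Site N) : (grid N).neighborFinset v =
    (Finset.univ.filter fun d => 0 < gap (N + 1) d (coord v)).image
      fun d => site N (step d (coord v)) := by
  ext u
  rw [SimpleGraph.mem_neighborFinset, adj_iff_step, Finset.mem_image]
  constructor
  · rintro ⟨d, hd, h⟩
    exact ⟨d, by simpa using hd, by rw [← h, site_coord]⟩
  · rintro ⟨d, hd, rfl⟩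
    have hd : 0 < gap (N + 1) d (coord v) := by simpa using hd
    have h := step_le (coord_le v).1 (coord_le v).2 hd
    exact ⟨d, hd, coord_site h.1 h.2⟩

theorem inside_iff_gap {N : ℕ} (v : Site N) :
    Inside (N + 1) (coord v) ↔ ∀ d, 0 < gap (N + 1) d (coord v) := by
  have := coord_le v
  generalize coord v = p at *
  obtain ⟨a, b⟩ := p
  simp only [Fin.forall_fin_succ]
  simp [Inside, gap] at this ⊢
  omega

/-- The degree is the number of directions with positive gap, and it is four exactly when every gap
is positive. -/
theorem mem_interior_iff {N : ℕ} (v : Site N) : v ∈ interior N ↔ Inside (N + 1) (coord v) := by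
  rw [interior, Finset.mem_filter, inside_iff_gap, ← SimpleGraph.card_neighborFinset_eq_degree,
    neighborFinset_eq, Finset.card_image_of_injOn (by simpa using step_injOn v)]
  have := Finset.card_eq_iff_eq_univ (Finset.univ.filter fun d => 0 < gap (N + 1) d (coord v))
  rw [Fintype.card_fin] at this
  rw [this, Finset.filter_eq_self]
  simp

theorem site_mem_interior {N : ℕ} {p : ℕ × ℕ} (hp : Inside (N + 1) p) : site N p ∈ interior N := by
  rw [mem_interior_iff, coord_site hp.2.1.le hp.2.2.2.le]
  exact hp

theorem sum_neighborFinset {N : ℕ} {p : ℕ × ℕ} (hp : Inside (N + 1) p) (f : Site N → ℤ) :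
    ∑ u ∈ (grid N).neighborFinset (site N p), f u = ∑ d, f (site N (step d p)) := by
  have hc := coord_site hp.2.1.le hp.2.2.2.le
  have hg := (inside_iff_gap (site N p)).1 (hc.symm ▸ hp)
  rw [neighborFinset_eq, Finset.sum_image (by simpa using step_injOn (site N p))]
  rw [Finset.filter_true_of_mem fun d _ => hg d, hc]

theorem step_mem_neighborFinset {N : ℕ} {p : ℕ × ℕ} (hp : Inside (N + 1) p) (d : Fin 4) :
    site N (step d p) ∈ (grid N).neighborFinset (site N p) := by
  have hc := coord_site hp.2.1.le hp.2.2.2.le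
  have hg := (inside_iff_gap (site N p)).1 (hc.symm ▸ hp)
  rw [neighborFinset_eq, Finset.mem_image]
  exact ⟨d, by simpa using hg d, by rw [hc]⟩

/-! ### The boundary cycle and one-run configurations -/

/-- The coordinates of the boundary site with index `t`, running twice around the boundary. -/
def boundaryPoint (K t : ℕ) : ℕ × ℕ :=
  if t < K then (0, t) else if t < 2 * K then (t - K, K) else if t < 3 * K then (K, 3 * K - t)
  else if t < 4 * K then (4 * K - t, 0) else if t < 5 * K then (0, t - 4 * K)
  else if t < 6 * K then (t - 5 * K, K) else if t < 7 * K then (K, 7 * K - t)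
  else (8 * K - t, 0)

theorem boundaryPoint_cases (K t : ℕ) :
    t < K ∧ boundaryPoint K t = (0, t) ∨
    K ≤ t ∧ t < 2 * K ∧ boundaryPoint K t = (t - K, K) ∨
    2 * K ≤ t ∧ t < 3 * K ∧ boundaryPoint K t = (K, 3 * K - t) ∨
    3 * K ≤ t ∧ t < 4 * K ∧ boundaryPoint K t = (4 * K - t, 0) ∨
    4 * K ≤ t ∧ t < 5 * K ∧ boundaryPoint K t = (0, t - 4 * K) ∨
    5 * K ≤ t ∧ t < 6 * K ∧ boundaryPoint K t = (t - 5 * K, K) ∨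
    6 * K ≤ t ∧ t < 7 * K ∧ boundaryPoint K t = (K, 7 * K - t) ∨
    7 * K ≤ t ∧ boundaryPoint K t = (8 * K - t, 0) := by
  unfold boundaryPoint
  split_ifs <;> simp <;> omega

theorem boundaryPoint_le (K t : ℕ) : (boundaryPoint K t).1 ≤ K ∧ (boundaryPoint K t).2 ≤ K := by
  rcases boundaryPoint_cases K t with ⟨_, h⟩ | ⟨_, _, h⟩ | ⟨_, _, h⟩ | ⟨_, _, h⟩ | ⟨_, _, h⟩ |
    ⟨_, _, h⟩ | ⟨_, _, h⟩ | ⟨_, h⟩ <;> rw [h] <;> simp <;> omega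

theorem boundaryPoint_not_inside (K t : ℕ) : ¬ Inside K (boundaryPoint K t) := by
  rcases boundaryPoint_cases K t with ⟨_, h⟩ | ⟨_, _, h⟩ | ⟨_, _, h⟩ | ⟨_, _, h⟩ | ⟨_, _, h⟩ |
    ⟨_, _, h⟩ | ⟨_, _, h⟩ | ⟨_, h⟩ <;> rw [h] <;> simp [Inside]

theorem boundaryPoint_add {K t : ℕ} (ht : t < 4 * K) :
    boundaryPoint K (t + 4 * K) = boundaryPoint K t := by
  have h' := boundaryPoint_cases K (t + 4 * K)
  generalize boundaryPoint K (t + 4 * K) = q at *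
  obtain ⟨a, b⟩ := q
  simp only [Prod.mk.injEq] at h'
  rcases boundaryPoint_cases K t with ⟨_, h⟩ | ⟨_, _, h⟩ | ⟨_, _, h⟩ | ⟨_, _, h⟩ | ⟨_, _, h⟩ |
    ⟨_, _, h⟩ | ⟨_, _, h⟩ | ⟨_, h⟩ <;> rw [h, Prod.mk.injEq] <;> omega

set_option maxHeartbeats 1000000 in
theorem boundaryPoint_ne {K t s : ℕ} (h : t < s) (h' : s < t + 4 * K) (hs : s < 8 * K) :
    boundaryPoint K t ≠ boundaryPoint K s := by
  intro he
  have h2 := boundaryPoint_cases K s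
  rw [← he] at h2
  rcases boundaryPoint_cases K t with ⟨_, h1⟩ | ⟨_, _, h1⟩ | ⟨_, _, h1⟩ | ⟨_, _, h1⟩ |
    ⟨_, _, h1⟩ | ⟨_, _, h1⟩ | ⟨_, _, h1⟩ | ⟨_, h1⟩ <;>
  simp only [h1, Prod.mk.injEq] at h2 <;> omega

/-- On each side, the formula for `boundaryPoint` also holds at both corners. -/
theorem boundaryPoint_sides (K t : ℕ) (ht : t < 8 * K) :
    (0 ≤ t → t ≤ K → boundaryPoint K t = (0, t)) ∧
    (K ≤ t → t ≤ 2 * K → boundaryPoint K t = (t - K, K)) ∧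
    (2 * K ≤ t → t ≤ 3 * K → boundaryPoint K t = (K, 3 * K - t)) ∧
    (3 * K ≤ t → t ≤ 4 * K → boundaryPoint K t = (4 * K - t, 0)) ∧
    (4 * K ≤ t → t ≤ 5 * K → boundaryPoint K t = (0, t - 4 * K)) ∧
    (5 * K ≤ t → t ≤ 6 * K → boundaryPoint K t = (t - 5 * K, K)) ∧
    (6 * K ≤ t → t ≤ 7 * K → boundaryPoint K t = (K, 7 * K - t)) ∧
    (7 * K ≤ t → t ≤ 8 * K → boundaryPoint K t = (8 * K - t, 0)) := by
  unfold boundaryPoint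
  refine ⟨?_, ?_, ?_, ?_, ?_, ?_, ?_, ?_⟩ <;> intro h h' <;> split_ifs <;>
    simp only [Prod.mk.injEq] <;> omega

/-- The case is selected by the position of the point rather than by its index, so that later
arguments can forget the index. -/
theorem boundaryPoint_succ {K t : ℕ} (ht : t + 1 < 8 * K) :
    (boundaryPoint K t).1 = 0 ∧ (boundaryPoint K t).2 < K ∧
      boundaryPoint K (t + 1) = (0, (boundaryPoint K t).2 + 1) ∨
    (boundaryPoint K t).2 = K ∧ (boundaryPoint K t).1 < K ∧
      boundaryPoint K (t + 1) = ((boundaryPoint K t).1 + 1, K) ∨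
    (boundaryPoint K t).1 = K ∧ 0 < (boundaryPoint K t).2 ∧
      boundaryPoint K (t + 1) = (K, (boundaryPoint K t).2 - 1) ∨
    (boundaryPoint K t).2 = 0 ∧ 0 < (boundaryPoint K t).1 ∧
      boundaryPoint K (t + 1) = ((boundaryPoint K t).1 - 1, 0) := by
  obtain ⟨a0, a1, a2, a3, a4, a5, a6, a7⟩ := boundaryPoint_sides K t (by omega)
  obtain ⟨b0, b1, b2, b3, b4, b5, b6, b7⟩ := boundaryPoint_sides K (t + 1) ht
  by_cases h0 : t < K
  · rw [a0 (by omega) (by omega), b0 (by omega) (by omega)]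
    simp only [Prod.mk.injEq, true_and, and_true]
    clear a0 a1 a2 a3 a4 a5 a6 a7 b0 b1 b2 b3 b4 b5 b6 b7
    omega
  by_cases h1 : t < 2 * K
  · rw [a1 (by omega) (by omega), b1 (by omega) (by omega)]
    simp only [Prod.mk.injEq, true_and, and_true]
    clear a0 a1 a2 a3 a4 a5 a6 a7 b0 b1 b2 b3 b4 b5 b6 b7
    omega
  by_cases h2 : t < 3 * K
  · rw [a2 (by omega) (by omega), b2 (by omega) (by omega)]
    simp only [Prod.mk.injEq, true_and]
    clear a0 a1 a2 a3 a4 a5 a6 a7 b0 b1 b2 b3 b4 b5 b6 b7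
    omega
  by_cases h3 : t < 4 * K
  · rw [a3 (by omega) (by omega), b3 (by omega) (by omega)]
    simp only [Prod.mk.injEq, true_and, and_true]
    clear a0 a1 a2 a3 a4 a5 a6 a7 b0 b1 b2 b3 b4 b5 b6 b7
    omega
  by_cases h4 : t < 5 * K
  · rw [a4 (by omega) (by omega), b4 (by omega) (by omega)]
    simp only [Prod.mk.injEq, true_and]
    clear a0 a1 a2 a3 a4 a5 a6 a7 b0 b1 b2 b3 b4 b5 b6 b7
    omega
  by_cases h5 : t < 6 * K
  · rw [a5 (by omega) (by omega), b5 (by omega) (by omega)]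
    simp only [Prod.mk.injEq, true_and, and_true]
    clear a0 a1 a2 a3 a4 a5 a6 a7 b0 b1 b2 b3 b4 b5 b6 b7
    omega
  by_cases h6 : t < 7 * K
  · rw [a6 (by omega) (by omega), b6 (by omega) (by omega)]
    simp only [Prod.mk.injEq, true_and]
    clear a0 a1 a2 a3 a4 a5 a6 a7 b0 b1 b2 b3 b4 b5 b6 b7
    omega
  rw [a7 (by omega) (by omega), b7 (by omega) (by omega)]
  simp only [Prod.mk.injEq, true_and, and_true]
  clear a0 a1 a2 a3 a4 a5 a6 a7 b0 b1 b2 b3 b4 b5 b6 b7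
  omega

/-- The boundary is a cycle without chords: a grid edge between boundary sites joins cyclically
consecutive ones. -/
theorem step_boundaryPoint {K t : ℕ} (ht : 0 < t) (ht' : t + 1 < 8 * K) {d : Fin 4}
    (hd : 0 < gap K d (boundaryPoint K t)) (hin : ¬ Inside K (step d (boundaryPoint K t))) :
    step d (boundaryPoint K t) = boundaryPoint K (t + 1) ∨
      step d (boundaryPoint K t) = boundaryPoint K (t - 1) := by
  have h0 := boundaryPoint_le K t
  have h3 := boundaryPoint_le K (t - 1)
  have h1 := boundaryPoint_succ ht'
  have h2 := boundaryPoint_succ (K := K) (t := t - 1) (by omega)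
  rw [Nat.sub_add_cancel ht] at h2
  generalize boundaryPoint K (t + 1) = q at *
  generalize boundaryPoint K (t - 1) = q' at *
  generalize boundaryPoint K t = p at *
  obtain ⟨a, b⟩ := p
  obtain ⟨a', b'⟩ := q'
  obtain ⟨a'', b''⟩ := q
  simp only [Prod.mk.injEq] at h0 h1 h2 h3
  fin_cases d <;> simp only [gap, step, Inside, Prod.mk.injEq] at hd hin ⊢ <;> omega

/-- The boundary word of a boundary configuration. -/
def boundaryWord {N : ℕ} (xb : BoundaryConfig N) (t : ℕ) : ℤ :=
  (glue (fun _ => 1) xb (site N (boundaryPoint (N + 1) t)) : ℤˣ)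

theorem glue_of_not_inside {N : ℕ} {xB yB : InteriorConfig N} {xb : BoundaryConfig N} {p : ℕ × ℕ}
    (h1 : p.1 ≤ N + 1) (h2 : p.2 ≤ N + 1) (hp : ¬ Inside (N + 1) p) :
    glue xB xb (site N p) = glue yB xb (site N p) := by
  have : site N p ∉ interior N := by rwa [mem_interior_iff, coord_site h1 h2]
  simp [glue, this]

theorem coord_boundaryPoint (N t : ℕ) :
    coord (site N (boundaryPoint (N + 1) t)) = boundaryPoint (N + 1) t :=
  coord_site (boundaryPoint_le _ _).1 (boundaryPoint_le _ _).2

theorem boundaryPoint_not_mem_interior (N t : ℕ) :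
    site N (boundaryPoint (N + 1) t) ∉ interior N := by
  rw [mem_interior_iff, coord_boundaryPoint]
  exact boundaryPoint_not_inside _ _

theorem mem_plusRun_iff {N : ℕ} (xb : BoundaryConfig N) (t : ℕ) :
    site N (boundaryPoint (N + 1) t) ∈ plusRun xb ↔ boundaryWord xb t = 1 := by
  have h := boundaryPoint_not_mem_interior N t
  simp [plusRun, boundaryWord, glue, h]

/-- Two `-1` sites on the boundary separate the boundary. -/
theorem eq_one_of_isOneRun {N : ℕ} {xb : BoundaryConfig N} (hxb : IsOneRun xb) {a b c d : ℕ}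
    (hab : a < b) (hbc : b < c) (hcd : c < d) (hda : d < a + 4 * (N + 1)) (hd : d < 8 * (N + 1))
    (ha : boundaryWord xb a = 1) (hc : boundaryWord xb c = 1) :
    boundaryWord xb b = 1 ∨ boundaryWord xb d = 1 := by
  by_contra hcon
  push Not at hcon
  have hreach := hxb ⟨_, (mem_plusRun_iff xb c).2 hc⟩ ⟨_, (mem_plusRun_iff xb a).2 ha⟩
  rw [SimpleGraph.reachable_iff_reflTransGen] at hreach
  -- A path in `R⁺` from `c` moves by one index at a time and cannot pass `b` or `d`, which carry
  -- `-1`; so it never reaches `a`.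
  have hinv : ∀ u, Relation.ReflTransGen ((grid N).induce (plusRun xb)).Adj
      ⟨_, (mem_plusRun_iff xb c).2 hc⟩ u →
      ∃ t, b < t ∧ t < d ∧ (u : Site N) = site N (boundaryPoint (N + 1) t) := by
    intro u hu
    induction hu with
    | refl => exact ⟨c, hbc, hcd, rfl⟩
    | @tail u v _ hadj ih =>
      obtain ⟨t, hbt, htd, hu⟩ := ih
      have hadj : (grid N).Adj u v := hadj
      have hv := v.2
      rw [adj_iff_step, hu, coord_boundaryPoint] at hadj
      obtain ⟨e, he, hve⟩ := hadj
      have hvin : ¬ Inside (N + 1) (coord (v : Site N)) := by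
        rw [← mem_interior_iff]
        exact hv.1
      rw [hve] at hvin
      rcases step_boundaryPoint (by omega) (by omega) he hvin with h | h
      · rw [← hve] at h
        have hv' : (v : Site N) = site N (boundaryPoint (N + 1) (t + 1)) := by
          rw [← h, site_coord]
        rw [hv', mem_plusRun_iff] at hv
        have : t + 1 ≠ d := by rintro rfl; exact hcon.2 hv
        exact ⟨t + 1, by omega, by omega, hv'⟩
      · rw [← hve] at h
        have hv' : (v : Site N) = site N (boundaryPoint (N + 1) (t - 1)) := by
          rw [← h, site_coord]
        rw [hv', mem_plusRun_iff] at hv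
        have : t - 1 ≠ b := by rintro rfl; exact hcon.1 hv
        exact ⟨t - 1, by omega, by omega, hv'⟩
  obtain ⟨t, hbt, htd, h⟩ := hinv _ hreach
  have h := congrArg coord h
  simp only [coord_boundaryPoint] at h
  exact boundaryPoint_ne (show a < t by omega) (by omega) (by omega) h

theorem oneRunWord_boundaryWord {N : ℕ} {xb : BoundaryConfig N} (hxb : IsOneRun xb) :
    OneRunWord (N + 1) (boundaryWord xb) := by
  have hper : ∀ t < 4 * (N + 1), boundaryWord xb (t + 4 * (N + 1)) = boundaryWord xb t := by
    intro t ht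
    rw [boundaryWord, boundaryPoint_add ht, boundaryWord]
  have hunit : ∀ t, boundaryWord xb t = 1 ∨ boundaryWord xb t = -1 := by
    intro t
    unfold boundaryWord
    rcases Int.units_eq_one_or (glue (fun _ => 1) xb (site N (boundaryPoint (N + 1) t))) with h | h
    · left; rw [h]; rfl
    · right; rw [h]; rfl
  refine ⟨hunit, hper, fun a b c d hab hbc hcd hda hd hac hbd => ?_⟩
  by_contra hne
  have ua := hunit a
  have ub := hunit b
  rcases ua with ha | ha
  · have := eq_one_of_isOneRun hxb hab hbc hcd hda hd ha (by omega)
    omega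
  -- Here `b` and `d` carry `+1`, so the quadruple is rotated to `b, c, d, a + 4(N + 1)`. If that
  -- leaves the second lap, `b, c, d` are moved back one lap instead.
  · rcases Nat.lt_or_ge a (4 * (N + 1)) with hlt | hge
    · have h1 := eq_one_of_isOneRun hxb hbc hcd hda (by omega) (by omega)
        (show boundaryWord xb b = 1 by omega) (by omega)
      have h2 := hper a hlt
      omega
    · have e : ∀ t, 4 * (N + 1) ≤ t → t < 8 * (N + 1) →
          boundaryWord xb (t - 4 * (N + 1)) = boundaryWord xb t := by
        intro t ht ht'
        rw [← hper (t - 4 * (N + 1)) (by omega), Nat.sub_add_cancel ht]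
      have e1 := e b (by omega) (by omega)
      have e2 := e c (by omega) (by omega)
      have e3 := e d (by omega) (by omega)
      have := eq_one_of_isOneRun hxb (a := b - 4 * (N + 1)) (b := c - 4 * (N + 1))
        (c := d - 4 * (N + 1)) (d := a) (by omega) (by omega) (by omega) (by omega) (by omega)
        (by omega) (by omega)
      omega

/-! ### Transfer of messages and costs to the graph -/

/-- The configuration on `ℕ × ℕ` given by an interior and a boundary configuration. -/
def glueInt {N : ℕ} (xB : InteriorConfig N) (xb : BoundaryConfig N) (p : ℕ × ℕ) : ℤ :=
  (glue xB xb (site N p) : ℤˣ)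

theorem extends_glueInt {N : ℕ} (xB : InteriorConfig N) (xb : BoundaryConfig N) :
    Extends (N + 1) (boundaryWord xb) (glueInt xB xb) := by
  have key : ∀ p t, boundaryPoint (N + 1) t = p → glueInt xB xb p = boundaryWord xb t := by
    rintro _ t rfl
    rw [glueInt, boundaryWord, glue_of_not_inside (boundaryPoint_le _ _).1 (boundaryPoint_le _ _).2
      (boundaryPoint_not_inside _ _)]
  refine ⟨fun p => ?_, fun i h h' => key _ _ ?_, fun i h h' => key _ _ ?_, fun i h h' => key _ _ ?_,
    fun i h h' => key _ _ ?_⟩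
  · unfold glueInt
    rcases Int.units_eq_one_or (glue xB xb (site N p)) with h | h
    · left; rw [h]; rfl
    · right; rw [h]; rfl
  · exact (boundaryPoint_sides (N + 1) i (by omega)).1 (by omega) (by omega)
  · rw [(boundaryPoint_sides (N + 1) (N + 1 + i) (by omega)).2.1 (by omega) (by omega)]
    refine Prod.ext ?_ ?_ <;> simp
  · rw [(boundaryPoint_sides (N + 1) (2 * (N + 1) + (N + 1 - i)) (by omega)).2.2.1 (by omega)
      (by omega)]
    exact Prod.ext rfl (by simp only; omega)
  · rw [(boundaryPoint_sides (N + 1) (3 * (N + 1) + (N + 1 - i)) (by omega)).2.2.2.1 (by omega)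
      (by omega)]
    exact Prod.ext (by simp only; omega) rfl

theorem incomingMessages_diffMessage {N : ℕ} (xb : BoundaryConfig N) :
    IncomingMessages (N + 1) (boundaryWord xb)
      (fun n d p => diffMessage xb n (site N (step d p)) (site N p)) := by
  refine ⟨fun n d p hp hin => ?_, fun n d p hp => ?_, fun n d p hin => ?_⟩
  · have hz := extends_glueInt (fun _ => 1) xb
    have hle := step_le (N := N) hp.2.1.le hp.2.2.2.le (d := d)
      (by have := (inside_iff_gap (site N p)).1; rw [coord_site hp.2.1.le hp.2.2.2.le] at this
          exact this hp d)
    have hni : site N (step d p) ∉ interior N := by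
      rwa [mem_interior_iff, coord_site hle.1 hle.2]
    have hval : diffMessage xb n (site N (step d p)) (site N p) =
        glueInt (fun _ => 1) xb (step d p) := by
      rw [diffMessage_boundary xb n _ _ hni]
      simp [glueInt, glue, hni]
    refine hval.trans ?_
    obtain ⟨r, c⟩ := p
    obtain ⟨hr, hr', hc, hc'⟩ := hp
    simp only at hr hr' hc hc'
    fin_cases d <;> simp [step, Inside] at hin <;> simp [step, lineEnd, gap]
    · obtain rfl : r = 1 := by omega
      exact hz.top c hc hc'
    · obtain rfl : N = c := by omega
      exact hz.right r hr hr'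
    · obtain rfl : N = r := by omega
      exact hz.bottom c hc hc'
    · obtain rfl : c = 1 := by omega
      exact hz.left r hr hr'
  · by_cases h : site N (step d p) ∈ interior N
    · cases n with
      | zero => rw [diffMessage_zero xb _ _ h]; norm_num
      | succ n =>
        simp only [diffMessage_succ xb n _ _ h]
        have := sign_cases (∑ k ∈ ((grid N).neighborFinset (site N (step d p))).erase (site N p),
          diffMessage xb n k (site N (step d p)))
        omega
    · simp only [diffMessage_boundary xb n _ _ h]
      rcases Int.units_eq_one_or (xb ⟨_, h⟩) with h | h <;> rw [h] <;> norm_num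
  -- The recipient `p` lies in direction `d + 2` from the sender, so erasing it leaves directions
  -- `d`, `d + 1`, `d + 3`.
  · have hback : step (d + 2) (step d p) = p := by
      obtain ⟨r, c⟩ := p
      fin_cases d <;> simp [step, Inside] at hin ⊢ <;> omega
    have hmem := step_mem_neighborFinset hin (d + 2)
    rw [hback] at hmem
    have hsum := Finset.add_sum_erase _ (fun k => diffMessage xb n k (site N (step d p))) hmem
    rw [sum_neighborFinset hin, sum_directions _ d, hback] at hsum
    rw [diffMessage_succ xb n _ _ (site_mem_interior hin)]
    congr 1
    linarith

/-- The bond from the site `p` to its right neighbor (`false`) or lower neighbor (`true`). -/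
def bond (N : ℕ) (x : Bool × ℕ × ℕ) : Sym2 (Site N) :=
  s(site N x.2, site N (if x.1 then (x.2.1 + 1, x.2.2) else (x.2.1, x.2.2 + 1)))

/-- The indices of the bonds that meet the interior of `[0, K]²`. -/
def bondIndices (K : ℕ) : Finset (Bool × ℕ × ℕ) :=
  ({false} ×ˢ Finset.Ioo 0 K ×ˢ Finset.range K) ∪ ({true} ×ˢ Finset.range K ×ˢ Finset.Ioo 0 K)

theorem mem_bondIndices {K : ℕ} {x : Bool × ℕ × ℕ} : x ∈ bondIndices K ↔
    (x.1 = false ∧ 0 < x.2.1 ∧ x.2.1 < K ∧ x.2.2 < K) ∨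
      (x.1 = true ∧ x.2.1 < K ∧ 0 < x.2.2 ∧ x.2.2 < K) := by
  simp only [bondIndices, Finset.mem_union, Finset.mem_product, Finset.mem_singleton,
    Finset.mem_Ioo, Finset.mem_range]
  tauto

theorem lineCost_eq_card (K : ℕ) (z : ℕ × ℕ → ℤ) : lineCost K z =
    ((bondIndices K).filter fun x =>
      z x.2 ≠ z (if x.1 then (x.2.1 + 1, x.2.2) else (x.2.1, x.2.2 + 1))).card := by
  have hdisj : Disjoint (({false} : Finset Bool) ×ˢ Finset.Ioo 0 K ×ˢ Finset.range K)
      ({true} ×ˢ Finset.range K ×ˢ Finset.Ioo 0 K) := by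
    rw [Finset.disjoint_left]
    rintro ⟨b, r, c⟩ h1 h2
    rw [Finset.mem_product, Finset.mem_singleton] at h1 h2
    exact absurd (h1.1.symm.trans h2.1) (by decide)
  rw [Finset.card_filter, bondIndices, Finset.sum_union hdisj, Finset.sum_product,
    Finset.sum_product]
  simp only [Finset.sum_singleton, Finset.sum_product, lineCost, changes]
  push_cast
  congr 1
  · refine Finset.sum_congr rfl fun r _ => Finset.sum_congr rfl fun c _ => ?_
    simp [chg, ite_not]
  · rw [Finset.sum_comm]
    refine Finset.sum_congr rfl fun r _ => Finset.sum_congr rfl fun c _ => ?_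
    simp [chg, ite_not]

theorem site_injOn {N : ℕ} {p q : ℕ × ℕ} (hp : p.1 ≤ N + 1 ∧ p.2 ≤ N + 1)
    (hq : q.1 ≤ N + 1 ∧ q.2 ≤ N + 1) (h : site N p = site N q) : p = q := by
  have := congrArg coord h
  rwa [coord_site hp.1 hp.2, coord_site hq.1 hq.2] at this

theorem bond_injOn (N : ℕ) : Set.InjOn (bond N) (bondIndices (N + 1)) := by
  rintro ⟨x, r, c⟩ hx ⟨y, r', c'⟩ hy h
  rw [Finset.mem_coe, mem_bondIndices] at hx hy
  simp only at hx hy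
  rw [bond, bond, Sym2.eq_iff] at h
  rcases hx with ⟨rfl, hx⟩ | ⟨rfl, hx⟩ <;> rcases hy with ⟨rfl, hy⟩ | ⟨rfl, hy⟩ <;>
    simp only [if_true, Bool.false_eq_true, if_false] at h <;>
    rcases h with ⟨h1, h2⟩ | ⟨h1, h2⟩ <;>
    replace h1 := site_injOn (by simp only; omega) (by simp only; omega) h1 <;>
    replace h2 := site_injOn (by simp only; omega) (by simp only; omega) h2 <;>
    simp only [Prod.mk.injEq] at h1 h2 ⊢ <;>
    first | (exfalso; omega) | exact ⟨trivial, by omega, by omega⟩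

theorem oddBonds_eq_lineCost {N : ℕ} (xB : InteriorConfig N) (xb : BoundaryConfig N) :
    (oddBonds xB xb : ℤ) = lineCost (N + 1) (glueInt xB xb) := by
  rw [lineCost_eq_card, oddBonds, Nat.cast_inj]
  symm
  apply Finset.card_nbij (bond N)
  · rintro ⟨b, r, c⟩ hx
    rw [Finset.mem_coe, Finset.mem_filter, mem_bondIndices] at hx
    obtain ⟨hx, hne⟩ := hx
    simp only at hx hne
    rw [Finset.mem_coe, Finset.mem_filter, SimpleGraph.mem_edgeFinset, bond,
      SimpleGraph.mem_edgeSet, adj_iff_coord]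
    rcases hx with ⟨rfl, hx⟩ | ⟨rfl, hx⟩ <;>
      simp only [if_true, Bool.false_eq_true, if_false] at hne ⊢ <;>
      rw [coord_site (by simp only; omega) (by simp only; omega),
        coord_site (by simp only; omega) (by simp only; omega)]
    · refine ⟨by simp, ?_, ?_⟩
      -- A bond starting on the left side has its right endpoint in the interior, as `0 < r < N + 1`
      -- forces `N + 1 ≥ 2`.
      · by_cases hc : c = 0
        · exact ⟨_, Sym2.mem_mk_right _ _, site_mem_interior
            ⟨hx.1, hx.2.1, by simp only; omega, by simp only; omega⟩⟩
        · exact ⟨_, Sym2.mem_mk_left _ _, site_mem_interior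
            ⟨hx.1, hx.2.1, by simp only; omega, by simp only; omega⟩⟩
      · rw [Sym2.map_mk, Sym2.mk_isDiag_iff]
        intro h
        exact hne (by simp only [glueInt, h])
    · refine ⟨by simp, ?_, ?_⟩
      · by_cases hr : r = 0
        · exact ⟨_, Sym2.mem_mk_right _ _, site_mem_interior
            ⟨by simp only; omega, by simp only; omega, hx.2⟩⟩
        · exact ⟨_, Sym2.mem_mk_left _ _, site_mem_interior
            ⟨by simp only; omega, by simp only; omega, hx.2⟩⟩
      · rw [Sym2.map_mk, Sym2.mk_isDiag_iff]
        intro h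
        exact hne (by simp only [glueInt, h])
  · exact (bond_injOn N).mono (Finset.coe_subset.2 (Finset.filter_subset _ _))
  · intro e he
    rw [Finset.mem_coe, Finset.mem_filter, SimpleGraph.mem_edgeFinset] at he
    obtain ⟨hadj, hint, hodd⟩ := he
    induction e using Sym2.ind with
    | _ u v =>
      rw [SimpleGraph.mem_edgeSet, adj_iff_coord] at hadj
      rw [Sym2.map_mk, Sym2.mk_isDiag_iff] at hodd
      have hint : Inside (N + 1) (coord u) ∨ Inside (N + 1) (coord v) := by
        obtain ⟨x, hx, hxi⟩ := hint
        rw [mem_interior_iff] at hxi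
        rcases Sym2.mem_iff.1 hx with rfl | rfl
        exacts [Or.inl hxi, Or.inr hxi]
      -- An unordered edge is first oriented to point right or down, the form indexed by
      -- `bondIndices`.
      have key : ∀ (a b : Site N) (t : Bool), s(a, b) = s(u, v) →
          coord b = (if t then ((coord a).1 + 1, (coord a).2) else
            ((coord a).1, (coord a).2 + 1)) →
          s(u, v) ∈ bond N '' ((bondIndices (N + 1)).filter fun x => glueInt xB xb x.2 ≠
            glueInt xB xb (if x.1 then (x.2.1 + 1, x.2.2) else (x.2.1, x.2.2 + 1)) :
              Finset (Bool × ℕ × ℕ)) := by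
        intro a b t hab hb
        have hint' : Inside (N + 1) (coord a) ∨ Inside (N + 1) (coord b) := by
          rcases Sym2.eq_iff.1 hab with ⟨rfl, rfl⟩ | ⟨rfl, rfl⟩
          exacts [hint, hint.symm]
        have hodd' : glue xB xb a ≠ glue xB xb b := by
          rcases Sym2.eq_iff.1 hab with ⟨rfl, rfl⟩ | ⟨rfl, rfl⟩
          exacts [hodd, Ne.symm hodd]
        refine ⟨(t, coord a), ?_, ?_⟩
        · rw [Finset.mem_coe, Finset.mem_filter, mem_bondIndices]
          simp only
          rw [← hb]
          constructor
          · have h1 := coord_le b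
            cases t <;> simp only [if_true, Bool.false_eq_true, if_false] at hb <;>
              rw [hb] at hint' h1 <;> simp [Inside] at hint' h1 ⊢ <;> omega
          · rw [glueInt, glueInt, site_coord, site_coord]
            exact fun h => hodd' (Units.ext h)
        · rw [bond]
          simp only
          rw [← hb, site_coord, site_coord, hab]
      rcases hadj with ⟨h1, h2 | h2⟩ | ⟨h1, h2 | h2⟩
      · exact key u v true rfl (by rw [if_pos rfl]; exact Prod.ext h2.symm h1.symm)
      · exact key v u true Sym2.eq_swap (by rw [if_pos rfl]; exact Prod.ext h2.symm h1)
      · exact key u v false rfl (by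
          rw [if_neg (by decide)]; exact Prod.ext h1.symm h2.symm)
      · exact key v u false Sym2.eq_swap (by
          rw [if_neg (by decide)]; exact Prod.ext h1 h2.symm)

/-- `Extends` leaves the four corners free, but no counted line passes through a corner. -/
theorem lineCost_congr {K : ℕ} {w : ℕ → ℤ} {y z : ℕ × ℕ → ℤ} (hy : Extends K w y)
    (hz : Extends K w z) (h : ∀ p, Inside K p → y p = z p) : lineCost K y = lineCost K z := by
  have hrow : ∀ r c, 0 < r → r < K → c ≤ K → y (r, c) = z (r, c) := by
    intro r c hr hr' hc
    rcases Nat.eq_zero_or_pos c with rfl | hc0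
    · rw [hy.left r hr hr', hz.left r hr hr']
    · rcases hc.lt_or_eq with hlt | rfl
      · exact h (r, c) ⟨hr, hr', hc0, hlt⟩
      · rw [hy.right r hr hr', hz.right r hr hr']
  have hcol : ∀ r c, 0 < c → c < K → r ≤ K → y (r, c) = z (r, c) := by
    intro r c hc hc' hr
    rcases Nat.eq_zero_or_pos r with rfl | hr0
    · rw [hy.top c hc hc', hz.top c hc hc']
    · rcases hr.lt_or_eq with hlt | rfl
      · exact h (r, c) ⟨hr0, hlt, hc, hc'⟩
      · rw [hy.bottom c hc hc', hz.bottom c hc hc']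
  unfold lineCost changes
  congr 1
  · refine Finset.sum_congr rfl fun r hr => Finset.sum_congr rfl fun c hc => ?_
    rw [Finset.mem_Ioo] at hr
    rw [Finset.mem_range] at hc
    simp only [hrow r c hr.1 hr.2 hc.le, hrow r (c + 1) hr.1 hr.2 hc]
  · refine Finset.sum_congr rfl fun c hc => Finset.sum_congr rfl fun r hr => ?_
    rw [Finset.mem_Ioo] at hc
    rw [Finset.mem_range] at hr
    simp only [hcol r c hc.1 hc.2 hr.le, hcol (r + 1) c hc.1 hc.2 hr]

theorem minOddBonds_eq_of_isMinCost {N : ℕ} (xb : BoundaryConfig N)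
    (i : {v : Site N // v ∈ interior N}) {s : ℤˣ} {m : ℤ}
    (h : IsMinCost (N + 1) (boundaryWord xb) (coord i.1) (s : ℤ) m) :
    (minOddBonds xb i s : ℤ) = m := by
  obtain ⟨⟨z, hz, hzi, hzm⟩, hle⟩ := h
  apply le_antisymm
  · let xB : InteriorConfig N := fun v => if z (coord v.1) = 1 then 1 else -1
    have hval : ∀ v : {v : Site N // v ∈ interior N}, ((xB v : ℤˣ) : ℤ) = z (coord v.1) := by
      intro v
      simp only [xB]
      rcases hz.unit (coord v.1) with h | h <;> simp [h]
    have hglue : ∀ p, Inside (N + 1) p → glueInt xB xb p = z p := by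
      intro p hp
      have hmem := site_mem_interior hp
      rw [glueInt, glue, dif_pos hmem, hval, coord_site hp.2.1.le hp.2.2.2.le]
    have hcost := lineCost_congr (extends_glueInt xB xb) hz hglue
    rw [← oddBonds_eq_lineCost] at hcost
    have hmem : xB ∈ Finset.univ.filter fun xB : InteriorConfig N => xB i = s := by
      rw [Finset.mem_filter]
      exact ⟨Finset.mem_univ _, Units.ext ((hval i).trans hzi)⟩
    have hinf : minOddBonds xb i s ≤ oddBonds xB xb :=
      Finset.inf'_le (fun xB => oddBonds xB xb) hmem
    have : (minOddBonds xb i s : ℤ) ≤ oddBonds xB xb := by exact_mod_cast hinf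
    linarith
  · obtain ⟨xB, hxB, heq⟩ := Finset.exists_mem_eq_inf'
      (s := Finset.univ.filter fun xB : InteriorConfig N => xB i = s) ⟨fun _ => s, by simp⟩
      fun xB => oddBonds xB xb
    rw [Finset.mem_filter] at hxB
    rw [minOddBonds, heq, oddBonds_eq_lineCost]
    refine hle _ (extends_glueInt xB xb) ?_
    rw [glueInt, site_coord, glue, dif_pos i.2]
    exact congrArg _ hxB.2

end BlockInterp

theorem theorem1 (N : ℕ) (xb : BlockInterp.BoundaryConfig N) (hxb : BlockInterp.IsOneRun xb) :
    (∀ j i : BlockInterp.Site N, (BlockInterp.grid N).Adj j i → j ∈ BlockInterp.interior N →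
      ∃ σ : ℤˣ, ∀ n : ℕ, 2 * N ≤ n → BlockInterp.diffMessage xb n j i = (σ : ℤ)) ∧
    (∀ i : {v : BlockInterp.Site N // v ∈ BlockInterp.interior N}, ∀ n : ℕ, 2 * N ≤ n →
      BlockInterp.estimate xb n i.1 = BlockInterp.localSolution xb i) := by
  open BlockInterp in
  have hw := oneRunWord_boundaryWord hxb
  have hI := incomingMessages_diffMessage xb
  constructor
  · intro j i hadj hj
    rw [mem_interior_iff] at hj
    obtain ⟨d, hd, hji⟩ := (adj_iff_step i j).1 hadj.symm
    rw [hji] at hj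
    obtain ⟨σ, hσ, h⟩ := hI.exists_limit hw hj
    simp only [← hji, site_coord] at h
    rcases hσ with rfl | rfl
    · exact ⟨1, h⟩
    · exact ⟨-1, h⟩
  · intro i n hn
    have hi := (mem_interior_iff i.1).1 i.2
    obtain ⟨a, b, ha, hb, hab⟩ :=
      -- Any interior filling serves here; it only supplies some configuration extending the
      -- boundary word.
      hI.sum_eq_sub_minCost hw (extends_glueInt (fun _ => 1) xb) hn hi
    have hsum := sum_neighborFinset hi (fun j => diffMessage xb n j i.1)
    rw [site_coord] at hsum hab
    rw [estimate, localSolution, minOddBonds_eq_of_isMinCost xb i (s := -1) ha,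
      minOddBonds_eq_of_isMinCost xb i (s := 1) hb, ← hab, hsum]
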